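/- Let $a>1$ be a real number, let $\gamma$ be the Euler–Mascheroni constant, let $\zeta$ and $\Gamma$ be the Riemann zeta function and the Gamma function on the complex plane, and put $s_k = \frac{2\pi i k}{\ln a}$ for $k\ge 1$. Then all the series below converge absolutely, and the following four identities hold: $$\sum_{n=0}^{\infty}\frac{1}{e^{a^n}-1} = \frac{\gamma-\ln(2\pi\sqrt a)}{\ln(a^2)}+\frac{a}{a-1}+\sum_{k=0}^{\infty}\frac{\zeta(-2k-1)}{(2k+1)!\,(a^{2k+1}-1)}+\frac{2}{\ln a}\,\Re\sum_{k=1}^{\infty}\Gamma(s_k)\zeta(s_k);$$ $$\sum_{n=0}^{\infty}\frac{1}{e^{a^n}+1} = -\frac{1}{2\ln a}\ln\!\left(\frac{2}{\pi\sqrt a}\right)-\frac12\sum_{k=1}^{\infty}\left(\coth\!\left(\tfrac{a^{-k}}{2}\right)-2\coth(a^{-k})\right)-\frac{\gamma}{2\ln a}-\frac{4}{\ln a}\,\Re\sum_{k=1}^{\infty}\left(2^{-s_k}-\tfrac12\right)\Gamma(s_k)\zeta(s_k);$$ $$\sum_{n=0}^{\infty}\frac{1}{\sinh(a^n)} = -\sum_{k=1}^{\infty}\left(\coth\!\left(\tfrac{a^{-k}}{2}\right)-\coth(a^{-k})-a^k\right)-\frac{a}{1-a}-\frac{\ln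 2}{\ln a}+\frac{4}{\ln a}\,\Re\sum_{k=1}^{\infty}\left(1-2^{-s_k}\right)\Gamma(s_k)\zeta(s_k);$$ $$\sum_{n=0}^{\infty}\frac{e^{-a^n}}{\sinh(a^n)} = -\frac{\ln\pi}{\ln a}-\frac12+\frac{a}{a-1}+\frac{\gamma}{\ln a}+\sum_{k=1}^{\infty}\left(a^k-\coth(a^{-k})\right)+\frac{4}{\ln a}\,\Re\sum_{k=1}^{\infty}\zeta(s_k)\,\Gamma(s_k)\,2^{-s_k}.$$ -/

import Mathlib

/-- The real hyperbolic cotangent (used only at positive arguments). -/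
noncomputable def realCoth (x : ℝ) : ℝ := Real.cosh x / Real.sinh x

/-- The point `2πik / ln a`, a zero of `1 - a^(-s)`. -/
noncomputable def imagPole (a : ℝ) (k : ℕ) : ℂ :=
  2 * (Real.pi : ℂ) * Complex.I * (k : ℂ) / ((Real.log a : ℝ) : ℂ)

/-! With f(x) = 1/(e^x - 1), all four summands and coth are, up to constants, linear combinations of
f(x) and f(2x). Everything therefore follows from one formula for the sum of f(c a^n),
`tsum_boseKernel_mul_pow`, taken at c = 1 and c = 2.

That formula is Poisson summation in the variable log x (`tsum_exp_mul_eq_tsum_mellin`): a sum over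
the points a^n, n in ℤ, becomes a sum of Mellin transforms at 2πik / log a. Since f(cx) = 1/(cx) -
1/2 + O(x) at 0, the two leading terms must be removed. `regBose` does so with differences of
cut-offs at scales a and 1. Their Mellin transforms carry the factor a^s - 1, so at the nonzero
frequencies only c^(-s) Γ(s) ζ(s) survives (`mellin_regBose_of_cpow_eq_one`). The frequency 0 is a
limit, which produces γ and log 2π (`mellin_regBose_zero`). Frequencies k and -k are conjugate,
hence the real parts.

The dual series converges absolutely because s(s-1)Γ(s)ζ(s) is the Mellin transform at s + 1 of (x
f)'', an integrable function, and so is bounded on the imaginary axis (`exists_norm_gammaZeta_le`);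
the terms are O(k^(-2)).

The samples at negative n form a series of Taylor remainders of f. For the coth identities it is
kept as it is; for the first identity it is expanded with the partial fractions of cot and resummed
into zeta values (`hasSum_boseCoeff_div`). -/

namespace BoseSum

/-! ### Elementary bounds and asymptotics of the Bose kernel and of (x f)''. -/

section Kernels

open Filter Topology Asymptotics MeasureTheory Set

/-- The kernels `e^(-x) / (1 - e^(-x))^j`; for `j = 1` this is the Bose kernel. -/
noncomputable def boseKernel (j : ℕ) (x : ℝ) : ℝ := Real.exp (-x) / (1 - Real.exp (-x)) ^ j

lemma one_sub_exp_neg_pos {x : ℝ} (hx : 0 < x) : 0 < 1 - Real.exp (-x) := by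
  have : Real.exp (-x) < 1 := Real.exp_lt_one_iff.mpr (by linarith)
  linarith

lemma div_le_one_sub_exp_neg {x : ℝ} (hx : 0 < x) : x / (1 + x) ≤ 1 - Real.exp (-x) := by
  have h1 : x + 1 ≤ Real.exp x := Real.add_one_le_exp x
  have h2 : Real.exp (-x) ≤ 1 / (1 + x) := by
    rw [Real.exp_neg, ← one_div]
    exact one_div_le_one_div_of_le (by linarith) (by linarith)
  have h3 : x / (1 + x) = 1 - 1 / (1 + x) := by field_simp; ring
  linarith

lemma boseKernel_nonneg (j : ℕ) {x : ℝ} (hx : 0 < x) : 0 ≤ boseKernel j x :=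
  div_nonneg (Real.exp_pos _).le (pow_nonneg (one_sub_exp_neg_pos hx).le _)

lemma boseKernel_le (j : ℕ) {x : ℝ} (hx : 0 < x) :
    boseKernel j x ≤ Real.exp (-x) * ((1 + x) / x) ^ j := by
  unfold boseKernel
  rw [div_eq_mul_inv, ← inv_pow]
  gcongr
  · exact (inv_pos.mpr (one_sub_exp_neg_pos hx)).le
  · rw [← inv_div]
    exact inv_anti₀ (by positivity) (div_le_one_sub_exp_neg hx)

lemma boseKernel_one {x : ℝ} (hx : 0 < x) : boseKernel 1 x = 1 / (Real.exp x - 1) := by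
  have h1 : (1 : ℝ) < Real.exp x := Real.one_lt_exp_iff.mpr hx
  have h2 : Real.exp x - 1 ≠ 0 := by linarith
  have h3 : 1 - (Real.exp x)⁻¹ ≠ 0 := by
    have := one_sub_exp_neg_pos hx
    rw [Real.exp_neg] at this
    exact this.ne'
  unfold boseKernel
  rw [Real.exp_neg, pow_one]
  field_simp

lemma continuousOn_boseKernel (j : ℕ) : ContinuousOn (boseKernel j) (Ioi 0) := by
  unfold boseKernel
  refine ContinuousOn.div (by fun_prop) (by fun_prop) fun x hx => ?_
  exact pow_ne_zero _ (one_sub_exp_neg_pos hx).ne'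

lemma isBigO_boseKernel_atTop (j : ℕ) :
    boseKernel j =O[atTop] fun x => Real.exp (-(1 : ℝ) * x) := by
  refine IsBigO.of_bound (2 ^ j) ?_
  filter_upwards [eventually_ge_atTop (1 : ℝ)] with x hx
  have hx0 : 0 < x := by linarith
  rw [Real.norm_of_nonneg (boseKernel_nonneg j hx0), Real.norm_of_nonneg (Real.exp_pos _).le,
    mul_comm, neg_one_mul]
  refine (boseKernel_le j hx0).trans ?_
  gcongr
  rw [div_le_iff₀ hx0]; linarith

lemma isBigO_boseKernel_zero (j : ℕ) :
    boseKernel j =O[𝓝[>] 0] fun x => x ^ (-(j : ℝ)) := by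
  refine IsBigO.of_bound (2 ^ j) ?_
  filter_upwards [Ioo_mem_nhdsGT (zero_lt_one : (0 : ℝ) < 1)] with x hx
  have hx0 : 0 < x := hx.1
  rw [Real.norm_of_nonneg (boseKernel_nonneg j hx0), Real.norm_of_nonneg (by positivity),
    Real.rpow_neg hx0.le, Real.rpow_natCast]
  refine (boseKernel_le j hx0).trans ?_
  rw [div_pow]
  calc Real.exp (-x) * ((1 + x) ^ j / x ^ j) ≤ 1 * (2 ^ j / x ^ j) := by
        gcongr
        · exact (Real.exp_lt_one_iff.mpr (by linarith)).le
        · linarith [hx.2]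
    _ = 2 ^ j * (x ^ j)⁻¹ := by rw [one_mul, div_eq_mul_inv]

/-- The numerator appearing in the Taylor remainder of the Bose kernel. -/
lemma bose_numerator_nonneg {x : ℝ} (hx : 0 ≤ x) : 0 ≤ (x - 2) * Real.exp x + x + 2 := by
  have hmono : MonotoneOn (fun x : ℝ => (x - 2) * Real.exp x + x + 2) (Ici 0) := by
    refine monotoneOn_of_deriv_nonneg (convex_Ici 0) (by fun_prop) (by fun_prop) ?_
    intro y hy
    rw [interior_Ici] at hy
    have hd : HasDerivAt (fun x : ℝ => (x - 2) * Real.exp x + x + 2)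
        (1 * Real.exp y + (y - 2) * Real.exp y + 1) y :=
      ((((hasDerivAt_id y).sub_const 2).mul (Real.hasDerivAt_exp y)).add
        (hasDerivAt_id y)).add_const 2
    rw [hd.deriv]
    have h1 : 1 - y ≤ Real.exp (-y) := by linarith [Real.add_one_le_exp (-y)]
    have h2 : Real.exp (-y) * Real.exp y = 1 := by rw [← Real.exp_add]; simp
    -- The derivative is e^y (e^(-y) - (1 - y)).
    nlinarith [Real.exp_pos y]
  have := hmono (mem_Ici.mpr le_rfl) (mem_Ici.mpr hx) hx
  simpa using this

lemma bose_numerator_le {x : ℝ} (hx : 0 ≤ x) :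
    (x - 2) * Real.exp x + x + 2 ≤ x ^ 3 * Real.exp x := by
  have key : (x + 2) * Real.exp (-x) ≤ x ^ 3 + 2 - x := by
    have hmono : MonotoneOn (fun x : ℝ => x ^ 3 + 2 - x - (x + 2) * Real.exp (-x)) (Ici 0) := by
      refine monotoneOn_of_deriv_nonneg (convex_Ici 0) (by fun_prop) (by fun_prop) ?_
      intro y hy
      rw [interior_Ici] at hy
      have hy0 : 0 < y := hy
      have hd : HasDerivAt (fun x : ℝ => x ^ 3 + 2 - x - (x + 2) * Real.exp (-x))
          (3 * y ^ 2 - 1 - (1 * Real.exp (-y) + (y + 2) * (Real.exp (-y) * (-1)))) y := by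
        have h1 : HasDerivAt (fun x : ℝ => x ^ 3) (3 * y ^ 2) y := by
          simpa using hasDerivAt_pow 3 y
        exact ((h1.add_const 2).sub (hasDerivAt_id y)).sub
          (((hasDerivAt_id y).add_const 2).mul ((hasDerivAt_neg y).exp))
      rw [hd.deriv]
      -- The derivative is 3y² - 1 + (y + 1)e^(-y), and this bound makes it at least 2y².
      have h1 : 1 - y ≤ Real.exp (-y) := by linarith [Real.add_one_le_exp (-y)]
      nlinarith
    have := hmono (mem_Ici.mpr le_rfl) (mem_Ici.mpr hx) hx
    simp only [neg_zero, Real.exp_zero] at this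
    linarith
  have h2 : Real.exp (-x) * Real.exp x = 1 := by rw [← Real.exp_add]; simp
  have := mul_le_mul_of_nonneg_right key (Real.exp_pos x).le
  nlinarith

/-- Over a common denominator the remainder is the numerator above divided by 2x(e^x - 1), and e^x -
1 ≥ x. Linear decay at 0 is what makes the samples at a^(-n) summable. -/
lemma abs_boseKernel_sub_le {x : ℝ} (hx : 0 < x) :
    |boseKernel 1 x - 1 / x + 1 / 2| ≤ x * Real.exp x := by
  have h1 : x + 1 ≤ Real.exp x := Real.add_one_le_exp x
  have h2 : 0 < Real.exp x - 1 := by linarith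
  have h3 : boseKernel 1 x - 1 / x + 1 / 2
      = ((x - 2) * Real.exp x + x + 2) / (2 * x * (Real.exp x - 1)) := by
    rw [boseKernel_one hx]; field_simp; ring
  rw [h3, abs_of_nonneg (div_nonneg (bose_numerator_nonneg hx.le) (by positivity)),
    div_le_iff₀ (by positivity)]
  refine (bose_numerator_le hx.le).trans ?_
  have h4 : 0 < Real.exp x := Real.exp_pos x
  have h5 : x * x ≤ x * (Real.exp x - 1) := mul_le_mul_of_nonneg_left (by linarith) hx.le
  have h6 : 0 ≤ x * Real.exp x := by positivity
  nlinarith [mul_le_mul_of_nonneg_left h5 h6]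

/-- The second derivative of `x / (e^x - 1)`. -/
noncomputable def boseSecond (x : ℝ) : ℝ :=
  -2 * boseKernel 2 x + x * (2 * boseKernel 3 x - boseKernel 2 x)

/-- The separate terms blow up at 0. The factored form shows a numerator of size O(x³), which
cancels the triple pole of `boseKernel 3`, and also gives the sign. -/
lemma boseSecond_eq {x : ℝ} (hx : 0 < x) :
    boseSecond x = Real.exp (-x) * ((x - 2) * Real.exp x + x + 2) * boseKernel 3 x := by
  have h1 := (one_sub_exp_neg_pos hx).ne'
  unfold boseSecond boseKernel
  have h2 : Real.exp x = (Real.exp (-x))⁻¹ := by rw [Real.exp_neg, inv_inv]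
  rw [h2]
  have h3 : Real.exp (-x) ≠ 0 := (Real.exp_pos _).ne'
  generalize Real.exp (-x) = r at *
  field_simp
  ring

lemma boseSecond_nonneg {x : ℝ} (hx : 0 < x) : 0 ≤ boseSecond x := by
  rw [boseSecond_eq hx]
  exact mul_nonneg (mul_nonneg (Real.exp_pos _).le (bose_numerator_nonneg hx.le))
    (boseKernel_nonneg 3 hx)

lemma boseSecond_le {x : ℝ} (hx : 0 < x) : boseSecond x ≤ x ^ 3 * boseKernel 3 x := by
  rw [boseSecond_eq hx]
  refine mul_le_mul_of_nonneg_right ?_ (boseKernel_nonneg 3 hx)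
  have h2 : Real.exp (-x) * Real.exp x = 1 := by rw [← Real.exp_add]; simp
  calc Real.exp (-x) * ((x - 2) * Real.exp x + x + 2)
      ≤ Real.exp (-x) * (x ^ 3 * Real.exp x) := by
        gcongr; exact bose_numerator_le hx.le
    _ = x ^ 3 := by rw [mul_left_comm, h2, mul_one]

lemma continuousOn_boseSecond : ContinuousOn boseSecond (Ioi 0) := by
  unfold boseSecond
  have h2 := continuousOn_boseKernel 2
  have h3 := continuousOn_boseKernel 3
  fun_prop

lemma isBigO_boseSecond_zero : boseSecond =O[𝓝[>] 0] fun x => x ^ (-(0 : ℝ)) := by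
  refine IsBigO.of_bound (2 ^ 3) ?_
  filter_upwards [Ioo_mem_nhdsGT (zero_lt_one : (0 : ℝ) < 1)] with x hx
  have hx0 : 0 < x := hx.1
  rw [Real.norm_of_nonneg (boseSecond_nonneg hx0), neg_zero, Real.rpow_zero, norm_one, mul_one]
  calc boseSecond x ≤ x ^ 3 * boseKernel 3 x := boseSecond_le hx0
    _ ≤ x ^ 3 * (Real.exp (-x) * ((1 + x) / x) ^ 3) := by
        gcongr; exact boseKernel_le 3 hx0
    _ = Real.exp (-x) * (1 + x) ^ 3 := by field_simp
    _ ≤ 1 * (1 + 1) ^ 3 := by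
        gcongr
        · exact (Real.exp_lt_one_iff.mpr (by linarith)).le
        · exact hx.2.le
    _ = 2 ^ 3 := by norm_num

lemma isBigO_boseSecond_atTop :
    boseSecond =O[atTop] fun x => Real.exp (-(1 / 2 : ℝ) * x) := by
  have h1 : boseSecond =O[atTop] fun x => x ^ 3 * boseKernel 3 x := by
    refine IsBigO.of_bound 1 ?_
    filter_upwards [eventually_gt_atTop (0 : ℝ)] with x hx
    rw [Real.norm_of_nonneg (boseSecond_nonneg hx), Real.norm_of_nonneg
      (mul_nonneg (by positivity) (boseKernel_nonneg 3 hx)), one_mul]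
    exact boseSecond_le hx
  -- Half of the exponential rate is spent on absorbing x³.
  have h2 : (fun x : ℝ => x ^ 3) =O[atTop] fun x => Real.exp (1 / 2 * x) :=
    (isLittleO_pow_exp_pos_mul_atTop 3 (by norm_num)).isBigO
  refine h1.trans ((h2.mul (isBigO_boseKernel_atTop 3)).congr_right fun x => ?_)
  rw [← Real.exp_add]
  congr 1; ring

end Kernels

/-! ### Mellin transforms of the kernels and boundedness of s(s-1)Γ(s)ζ(s). -/

section MellinKernels

open Filter Topology Asymptotics MeasureTheory Set

lemma isBigO_ofReal_left {l : Filter ℝ} {f g : ℝ → ℝ} (h : f =O[l] g) :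
    (fun x => (f x : ℂ)) =O[l] g :=
  (IsBigO.of_bound 1 (Eventually.of_forall fun x => by simp)).trans h

lemma locallyIntegrableOn_ofReal {f : ℝ → ℝ} (h : ContinuousOn f (Ioi 0)) :
    LocallyIntegrableOn (fun x => (f x : ℂ)) (Ioi 0) :=
  (Complex.continuous_ofReal.comp_continuousOn h).locallyIntegrableOn measurableSet_Ioi

lemma mellinConvergent_boseKernel (j : ℕ) {s : ℂ} (hs : j < s.re) :
    MellinConvergent (fun x => (boseKernel j x : ℂ)) s :=
  mellinConvergent_of_isBigO_rpow_exp one_pos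
    (locallyIntegrableOn_ofReal (continuousOn_boseKernel j))
    (isBigO_ofReal_left (isBigO_boseKernel_atTop j))
    (isBigO_ofReal_left (isBigO_boseKernel_zero j)) hs

/-- The Mellin transform of `∑ (n+1)^k e^(-(n+1)x)` is `Γ(s) ζ(s-k)`. -/
lemma mellin_of_hasSum_pow_mul_exp (k : ℕ) {F : ℝ → ℂ} {s : ℂ} (hs : k + 1 < s.re)
    (hF : ∀ t ∈ Ioi (0 : ℝ),
      HasSum (fun n : ℕ => ((n : ℂ) + 1) ^ k * Real.exp (-((n : ℝ) + 1) * t)) (F t)) :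
    mellin F s = Complex.Gamma s * riemannZeta (s - k) := by
  have hre : 1 < (s - k).re := by simp; linarith
  have hterm : ∀ n : ℕ, ((n : ℂ) + 1) ^ k / ((n : ℂ) + 1) ^ s = 1 / ((n : ℂ) + 1) ^ (s - k) := by
    intro n
    have hn : (n : ℂ) + 1 ≠ 0 := Nat.cast_add_one_ne_zero n
    rw [Complex.cpow_sub _ _ hn, Complex.cpow_natCast, one_div_div]
  have h := hasSum_mellin (a := fun n : ℕ => ((n : ℂ) + 1) ^ k) (p := fun n : ℕ => (n : ℝ) + 1)
    (F := F) (s := s) (fun n => Or.inr (by positivity))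
    (by have : (0 : ℝ) ≤ k := Nat.cast_nonneg k
        linarith) hF ?_
  · rw [← h.tsum_eq, zeta_eq_tsum_one_div_nat_add_one_cpow hre, ← tsum_mul_left]
    refine tsum_congr fun n => ?_
    rw [← hterm n, mul_div_assoc]
    push_cast
    rfl
  · have h1 : Summable fun n : ℕ => ((n : ℝ) ^ (s.re - k))⁻¹ :=
      Real.summable_nat_rpow_inv.mpr (by simpa using hre)
    refine ((summable_nat_add_iff 1).mpr h1).congr fun n => ?_
    have hn : (0 : ℝ) < (n : ℝ) + 1 := by positivity
    have h2 : ‖((n : ℂ) + 1) ^ k‖ = ((n : ℝ) + 1) ^ k := by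
      rw [norm_pow]
      congr 1
      exact_mod_cast Complex.norm_natCast (n + 1)
    rw [h2]
    push_cast
    rw [Real.rpow_sub hn, Real.rpow_natCast, inv_div]

lemma hasSum_choose_mul_exp (j : ℕ) {t : ℝ} (ht : 0 < t) :
    HasSum (fun n : ℕ => ((n + j).choose j : ℝ) * Real.exp (-((n : ℝ) + 1) * t))
      (boseKernel (j + 1) t) := by
  have h0 : ‖Real.exp (-t)‖ < 1 := by
    rw [Real.norm_of_nonneg (Real.exp_pos _).le]
    exact Real.exp_lt_one_iff.mpr (by linarith)
  have h := (hasSum_choose_mul_geometric_of_norm_lt_one j h0).mul_left (Real.exp (-t))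
  have he : boseKernel (j + 1) t = Real.exp (-t) * (1 / (1 - Real.exp (-t)) ^ (j + 1)) := by
    simp [boseKernel, div_eq_mul_inv]
  rw [he]
  refine h.congr_fun fun n => ?_
  rw [← Real.exp_nat_mul, mul_left_comm, ← Real.exp_add]
  congr 2; ring

lemma mellin_boseKernel_one {s : ℂ} (hs : 1 < s.re) :
    mellin (fun x => (boseKernel 1 x : ℂ)) s = Complex.Gamma s * riemannZeta s := by
  rw [mellin_of_hasSum_pow_mul_exp 0 (by simpa using hs), Nat.cast_zero, sub_zero]
  intro t ht
  have := Complex.hasSum_ofReal.mpr (hasSum_choose_mul_exp 0 ht)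
  refine this.congr_fun fun n => ?_
  simp

lemma mellin_boseKernel_two {s : ℂ} (hs : 2 < s.re) :
    mellin (fun x => (boseKernel 2 x : ℂ)) s = Complex.Gamma s * riemannZeta (s - 1) := by
  rw [mellin_of_hasSum_pow_mul_exp 1 (by norm_num; exact hs), Nat.cast_one]
  intro t ht
  have := Complex.hasSum_ofReal.mpr (hasSum_choose_mul_exp 1 ht)
  refine this.congr_fun fun n => ?_
  simp

/-- The combination is chosen so that its exponential series has coefficients 2·C(n+2, 2) - (n+1) =
(n+1)². -/
lemma mellin_boseKernel_three {s : ℂ} (hs : 3 < s.re) :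
    mellin (fun x => ((2 * boseKernel 3 x - boseKernel 2 x : ℝ) : ℂ)) s
      = Complex.Gamma s * riemannZeta (s - 2) := by
  rw [mellin_of_hasSum_pow_mul_exp 2 (by norm_num; linarith), Nat.cast_two]
  intro t ht
  have := Complex.hasSum_ofReal.mpr (((hasSum_choose_mul_exp 2 ht).mul_left 2).sub
    (hasSum_choose_mul_exp 1 ht))
  refine this.congr_fun fun n => ?_
  have h2 : ((n + 2).choose 2 : ℝ) = ((n : ℝ) + 2) * (n + 1) / 2 := by
    rw [Nat.cast_choose_two]; push_cast; ring
  rw [h2]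
  push_cast [Nat.choose_one_right]
  ring

/-- The completion of `s (s - 1) Γ(s) ζ(s)`. -/
noncomputable def gammaZeta (s : ℂ) : ℂ := Complex.Gamma (s + 1) * riemannZeta₁ s

lemma gammaZeta_eq {s : ℂ} (h0 : s ≠ 0) (h1 : s ≠ 1) :
    gammaZeta s = s * (s - 1) * (Complex.Gamma s * riemannZeta s) := by
  have h2 : s - 1 ≠ 0 := sub_ne_zero.mpr h1
  rw [gammaZeta, Complex.Gamma_add_one s h0, riemannZeta_eq_inv_sub_mul h1]
  field_simp

/-- No integration by parts is needed: the pieces give -2Γ(s+1)ζ(s) + Γ(s+2)ζ(s) = s(s-1)Γ(s)ζ(s).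
The half-plane is the one where `boseKernel 2` and `boseKernel 3` have convergent transforms at s+1
and s+2. -/
lemma mellin_boseSecond_of_lt {s : ℂ} (hs : 1 < s.re) :
    mellin (fun x => (boseSecond x : ℂ)) (s + 1) = gammaZeta s := by
  have hs0 : s ≠ 0 := by rintro rfl; simp at hs; linarith
  have hs1 : s ≠ 1 := by rintro rfl; simp at hs
  have hs2 : s + 1 ≠ 0 := by
    intro h
    have := congrArg Complex.re h
    simp at this; linarith
  have c2 : MellinConvergent (fun x => (boseKernel 2 x : ℂ)) (s + 1) :=
    mellinConvergent_boseKernel 2 (by simp; linarith)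
  have c2' : MellinConvergent (fun x => (boseKernel 2 x : ℂ)) (s + 1 + 1) :=
    mellinConvergent_boseKernel 2 (by simp; linarith)
  have c3 : MellinConvergent (fun x => (boseKernel 3 x : ℂ)) (s + 1 + 1) :=
    mellinConvergent_boseKernel 3 (by simp; linarith)
  have c4 : MellinConvergent (fun x => ((2 * boseKernel 3 x - boseKernel 2 x : ℝ) : ℂ))
      (s + 1 + 1) := by
    have := (hasMellin_sub (c3.const_smul (2 : ℂ)) c2').1
    simpa using this
  have c5 := MellinConvergent.cpow_smul.mpr c4
  have key := (hasMellin_add (c2.const_smul (-2 : ℂ)) c5).2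
  have heq : mellin (fun x => (boseSecond x : ℂ)) (s + 1)
      = mellin (fun t => (-2 : ℂ) • (boseKernel 2 t : ℂ) +
        (t : ℂ) ^ (1 : ℂ) • ((2 * boseKernel 3 t - boseKernel 2 t : ℝ) : ℂ)) (s + 1) := by
    congr 1
    funext t
    simp [boseSecond]
  rw [heq, key, mellin_const_smul, mellin_cpow_smul, mellin_boseKernel_two (by simp; linarith),
    mellin_boseKernel_three (by simp; linarith), gammaZeta_eq hs0 hs1,
    Complex.Gamma_add_one _ hs2, Complex.Gamma_add_one _ hs0]
  have e1 : s + 1 - 1 = s := by ring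
  have e2 : s + 1 + 1 - 2 = s := by ring
  rw [e1, e2, smul_eq_mul]
  ring

lemma convex_re_gt_neg_one : Convex ℝ {s : ℂ | -1 < s.re} := convex_halfSpace_re_gt (-1)

lemma isOpen_re_gt_neg_one : IsOpen {s : ℂ | -1 < s.re} :=
  isOpen_lt continuous_const Complex.continuous_re

/-- Two holomorphic functions on `Re s > -1` that agree on `Re s > 1` are equal. -/
lemma eq_of_eq_of_one_lt_re {F G : ℂ → ℂ} (hF : ∀ s : ℂ, -1 < s.re → DifferentiableAt ℂ F s)
    (hG : ∀ s : ℂ, -1 < s.re → DifferentiableAt ℂ G s) (h : ∀ s : ℂ, 1 < s.re → F s = G s)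
    {s : ℂ} (hs : -1 < s.re) : F s = G s := by
  have hF' : AnalyticOnNhd ℂ F {s : ℂ | -1 < s.re} :=
    DifferentiableOn.analyticOnNhd (fun z hz => (hF z hz).differentiableWithinAt)
      isOpen_re_gt_neg_one
  have hG' : AnalyticOnNhd ℂ G {s : ℂ | -1 < s.re} :=
    DifferentiableOn.analyticOnNhd (fun z hz => (hG z hz).differentiableWithinAt)
      isOpen_re_gt_neg_one
  refine hF'.eqOn_of_preconnected_of_eventuallyEq hG' convex_re_gt_neg_one.isPreconnected
    (z₀ := 2) (by simp; norm_num) ?_ hs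
  filter_upwards [(isOpen_lt continuous_const Complex.continuous_re).mem_nhds
    (show (2 : ℂ) ∈ {s : ℂ | 1 < s.re} by simp)] with z hz using h z hz

lemma differentiableAt_gammaZeta {s : ℂ} (hs : -1 < s.re) : DifferentiableAt ℂ gammaZeta s := by
  unfold gammaZeta
  have h1 : DifferentiableAt ℂ Complex.Gamma (s + 1) := by
    refine Complex.differentiableAt_Gamma _ fun m h => ?_
    have := congrArg Complex.re h
    simp at this
    have hm : (0 : ℝ) ≤ m := Nat.cast_nonneg m
    linarith
  have h2 : DifferentiableAt ℂ (fun s => Complex.Gamma (s + 1)) s :=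
    DifferentiableAt.comp (g := Complex.Gamma) s h1 (by fun_prop)
  exact h2.mul differentiable_riemannZeta₁.differentiableAt

/-- Boundedness of `boseSecond` at 0 makes the left side holomorphic for Re s > -1, so the identity
continues across the imaginary axis. -/
lemma mellin_boseSecond {s : ℂ} (hs : -1 < s.re) :
    mellin (fun x => (boseSecond x : ℂ)) (s + 1) = gammaZeta s := by
  refine eq_of_eq_of_one_lt_re (F := fun s => mellin (fun x => (boseSecond x : ℂ)) (s + 1))
    ?_ (fun z hz => differentiableAt_gammaZeta hz) (fun z hz => mellin_boseSecond_of_lt hz) hs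
  intro z hz
  have h1 : DifferentiableAt ℂ (mellin fun x => (boseSecond x : ℂ)) (z + 1) :=
    mellin_differentiableAt_of_isBigO_rpow_exp (b := 0) (by norm_num)
      (locallyIntegrableOn_ofReal continuousOn_boseSecond)
      (isBigO_ofReal_left isBigO_boseSecond_atTop) (isBigO_ofReal_left isBigO_boseSecond_zero)
      (by simp; linarith)
  exact DifferentiableAt.comp (g := mellin fun x => (boseSecond x : ℂ)) z h1 (by fun_prop)

/-- `s (s - 1) Γ(s) ζ(s)` is bounded on the imaginary axis. -/
lemma exists_norm_gammaZeta_le : ∃ C : ℝ, ∀ s : ℂ, s.re = 0 → ‖gammaZeta s‖ ≤ C := by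
  refine ⟨∫ t in Ioi (0 : ℝ), ‖(boseSecond t : ℂ)‖, fun s hs => ?_⟩
  rw [← mellin_boseSecond (by rw [hs]; norm_num), mellin]
  refine (norm_integral_le_integral_norm _).trans_eq ?_
  refine setIntegral_congr_fun measurableSet_Ioi fun t ht => ?_
  have ht0 : (0 : ℝ) < t := ht
  simp only [norm_smul]
  rw [Complex.norm_cpow_eq_rpow_re_of_pos ht0]
  simp [hs]

end MellinKernels

/-! ### Poisson summation on the multiplicative group. -/

section MellinPoisson

open Filter Topology Asymptotics MeasureTheory Set FourierTransform

/-- Poisson summation along a geometric progression, in terms of the Mellin transform. -/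
lemma tsum_exp_mul_eq_tsum_mellin {p : ℝ → ℂ} {L : ℝ} (hL : 0 < L)
    (hc : ContinuousOn p (Ioi 0)) (h0 : p =O[𝓝[>] 0] fun x => x)
    (htop : p =O[atTop] fun x => x⁻¹)
    (hs : Summable fun k : ℤ => mellin p (2 * Real.pi * Complex.I * k / L)) :
    ∑' n : ℤ, p (Real.exp (L * n)) =
      (L : ℂ)⁻¹ * ∑' k : ℤ, mellin p (2 * Real.pi * Complex.I * k / L) := by
  -- The power L rescales the period to 1, and this shape fits `mellin_eq_fourier` followed by
  -- `mellin_comp_rpow`.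
  set φ : ℝ → ℂ := fun u => p (Real.exp (-u) ^ L) with hφ
  have hexp : ∀ u : ℝ, Real.exp (-u) ^ L = Real.exp (-(L * u)) := by
    intro u; rw [← Real.exp_mul]; congr 1; ring
  have hφ' : ∀ u : ℝ, φ u = p (Real.exp (-(L * u))) := fun u => by simp only [hφ, hexp]
  have hcont : Continuous φ := by
    have : φ = fun u => p (Real.exp (-(L * u))) := funext hφ'
    rw [this]
    exact hc.comp_continuous (by fun_prop) fun u => Real.exp_pos _
  have hF : ∀ k : ℤ, 𝓕 φ (k : ℝ) = (L : ℂ)⁻¹ * mellin p (2 * Real.pi * Complex.I * k / L) := by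
    intro k
    have h1 := mellin_eq_fourier (fun t => p (t ^ L)) (s := 2 * Real.pi * Complex.I * k)
    have h2 := mellin_comp_rpow p (2 * Real.pi * Complex.I * k) L
    rw [h2, abs_of_pos hL] at h1
    have hre : (2 * Real.pi * Complex.I * k : ℂ).re = 0 := by simp
    have him : (2 * Real.pi * Complex.I * k : ℂ).im / (2 * Real.pi) = k := by
      simp [field]
    rw [hre, him] at h1
    simp only [neg_zero, zero_mul, Real.exp_zero, one_smul] at h1
    rw [hφ, ← h1, Complex.real_smul, Complex.ofReal_inv]
  have hdecayTop : ∀ {q : ℝ → ℂ}, (q =O[atTop] fun u => Real.exp (-(L * u))) →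
      q =O[atTop] fun u => |u| ^ (-2 : ℝ) := by
    intro q hq
    have h1 : (fun u => Real.exp (-(L * u))) =O[atTop] fun u : ℝ => |u| ^ (-2 : ℝ) := by
      have := (isLittleO_exp_neg_mul_rpow_atTop hL (-2)).isBigO
      refine (this.congr_left fun u => by rw [neg_mul]).congr' EventuallyEq.rfl ?_
      filter_upwards [eventually_ge_atTop (0 : ℝ)] with u hu
      rw [abs_of_nonneg hu]
    exact hq.trans h1
  have htend : Tendsto (fun u : ℝ => L * u) atTop atTop := tendsto_id.const_mul_atTop hL
  have hA : φ =O[atTop] fun u => Real.exp (-(L * u)) := by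
    have h1 : Tendsto (fun u : ℝ => Real.exp (-(L * u))) atTop (𝓝[>] 0) :=
      tendsto_nhdsWithin_iff.mpr ⟨Real.tendsto_exp_neg_atTop_nhds_zero.comp htend,
        Eventually.of_forall fun u => Real.exp_pos _⟩
    exact (h0.comp_tendsto h1).congr_left fun u => (hφ' u).symm
  have hB : (fun u => φ (-u)) =O[atTop] fun u => Real.exp (-(L * u)) := by
    have h1 : Tendsto (fun u : ℝ => Real.exp (L * u)) atTop atTop :=
      Real.tendsto_exp_atTop.comp htend
    refine ((htop.comp_tendsto h1).congr_left fun u => ?_).congr_right fun u => ?_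
    · rw [hφ']; simp
    · simp [Real.exp_neg]
  have hdecay : φ =O[cocompact ℝ] fun u => |u| ^ (-2 : ℝ) := by
    rw [cocompact_eq_atBot_atTop, isBigO_sup]
    refine ⟨?_, hdecayTop hA⟩
    have := (hdecayTop hB).comp_tendsto tendsto_neg_atBot_atTop
    refine (this.congr_left fun u => ?_).congr_right fun u => ?_
    · simp
    · simp
  have hsum : Summable fun k : ℤ => 𝓕 φ (k : ℝ) := by
    simp_rw [hF]
    exact hs.mul_left _
  have key := Real.tsum_eq_tsum_fourier_of_rpow_decay_of_summable hcont one_lt_two hdecay hsum 0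
  simp only [zero_add, QuotientAddGroup.mk_zero, fourier_eval_zero, mul_one, hF] at key
  rw [tsum_mul_left] at key
  -- The reflection undoes the sign in exp(-u).
  rw [← key, ← (Equiv.neg ℤ).tsum_eq]
  refine tsum_congr fun n => ?_
  rw [hφ']
  simp

end MellinPoisson

/-! ### Cut-offs that remove the singular part at 0, and the regularised kernel. -/

section Compensators

open Filter Topology Asymptotics MeasureTheory Set

lemma _root_.HasMellin.congr_Ioi {f g : ℝ → ℂ} {s m : ℂ} (h : HasMellin f s m)
    (hfg : ∀ x : ℝ, 0 < x → f x = g x) : HasMellin g s m := by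
  have h1 : EqOn (fun t : ℝ => (t : ℂ) ^ (s - 1) • f t) (fun t : ℝ => (t : ℂ) ^ (s - 1) • g t)
      (Ioi 0) := fun t ht => by simp only [hfg t ht]
  refine ⟨h.1.congr_fun h1 measurableSet_Ioi, ?_⟩
  rw [← h.2]
  exact (setIntegral_congr_fun measurableSet_Ioi h1).symm

/-- The function `1/x - 1` cut off at `x = 1`. -/
noncomputable def invCut (x : ℝ) : ℝ := max 0 (x⁻¹ - 1)

/-- The function `-log x` cut off at `x = 1`. -/
noncomputable def logCut (x : ℝ) : ℝ := max 0 (-Real.log x)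

lemma invCut_of_le {x : ℝ} (h0 : 0 < x) (h1 : x ≤ 1) : invCut x = x⁻¹ - 1 :=
  max_eq_right (by linarith [(one_le_inv₀ h0).mpr h1])

lemma invCut_of_ge {x : ℝ} (h1 : 1 ≤ x) : invCut x = 0 :=
  max_eq_left (by linarith [inv_le_one_of_one_le₀ h1])

lemma logCut_of_le {x : ℝ} (h0 : 0 < x) (h1 : x ≤ 1) : logCut x = -Real.log x :=
  max_eq_right (by linarith [Real.log_nonpos h0.le h1])

lemma logCut_of_ge {x : ℝ} (h1 : 1 ≤ x) : logCut x = 0 :=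
  max_eq_left (by linarith [Real.log_nonneg h1])

lemma continuousOn_invCut : ContinuousOn invCut (Ioi 0) := by
  unfold invCut
  exact continuousOn_const.sup ((continuousOn_inv₀.mono fun x hx => (ne_of_gt hx)).sub
    continuousOn_const)

lemma continuousOn_logCut : ContinuousOn logCut (Ioi 0) := by
  unfold logCut
  exact continuousOn_const.sup (Real.continuousOn_log.mono fun x hx => (ne_of_gt hx)).neg

lemma hasMellin_invCut {s : ℂ} (hs : 1 < s.re) :
    HasMellin (fun x => (invCut x : ℂ)) s (1 / (s * (s - 1))) := by
  have hs0 : s ≠ 0 := by rintro rfl; simp at hs; linarith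
  have hs1 : s - 1 ≠ 0 := by
    refine sub_ne_zero.mpr ?_
    rintro rfl; simp at hs
  have h1 := hasMellin_cpow_Ioc (-1) (s := s) (by simp; linarith)
  have h2 := hasMellin_one_Ioc (s := s) (by linarith)
  have h3 := hasMellin_sub h1.1 h2.1
  rw [h1.2, h2.2] at h3
  have e : 1 / (s + -1) - 1 / s = 1 / (s * (s - 1)) := by
    rw [← sub_eq_add_neg]; field_simp; ring
  rw [e] at h3
  refine h3.congr_Ioi fun x hx => ?_
  by_cases hx1 : x ≤ 1
  · have hm : x ∈ Ioc (0 : ℝ) 1 := ⟨hx, hx1⟩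
    simp only [indicator_of_mem hm]
    rw [invCut_of_le hx hx1, Complex.cpow_neg_one]
    push_cast; ring
  · have hm : x ∉ Ioc (0 : ℝ) 1 := fun h => hx1 h.2
    simp only [indicator_of_notMem hm]
    rw [invCut_of_ge (not_le.mp hx1).le]
    simp

/-- Multiplication by log x is differentiation in s, so this is minus the derivative of 1/s, the
transform of the indicator of (0, 1]. -/
lemma hasMellin_logCut {s : ℂ} (hs : 0 < s.re) :
    HasMellin (fun x => (logCut x : ℂ)) s (1 / s ^ 2) := by
  have hs0 : s ≠ 0 := by rintro rfl; simp at hs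
  set f : ℝ → ℂ := indicator (Ioc 0 1) (fun _ => 1) with hf
  have hbound : ∀ x, ‖f x‖ ≤ 1 := fun x => by
    simpa using norm_indicator_le_norm_self (s := Ioc (0 : ℝ) 1) (fun _ : ℝ => (1 : ℂ)) x
  have hloc : LocallyIntegrableOn f (Ioi 0) := by
    have : Integrable f :=
      (integrable_indicator_iff measurableSet_Ioc).mpr (by simp)
    exact this.locallyIntegrable.locallyIntegrableOn _
  -- Any exponent above Re s would do, since f vanishes beyond 1.
  have htop : f =O[atTop] fun x => x ^ (-(s.re + 1)) := by
    refine IsBigO.of_bound 1 ?_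
    filter_upwards [eventually_gt_atTop (1 : ℝ)] with x hx
    rw [hf, indicator_of_notMem fun h => absurd h.2 (not_le.mpr hx)]
    simp
  have hbot : f =O[𝓝[>] 0] fun x => x ^ (-(0 : ℝ)) := by
    refine IsBigO.of_bound 1 (Eventually.of_forall fun x => ?_)
    simpa using hbound x
  obtain ⟨hconv, hderiv⟩ :=
    mellin_hasDerivAt_of_isBigO_rpow hloc htop (lt_add_one _) hbot hs
  have hderiv' : HasDerivAt (mellin f) (-(1 : ℂ) / s ^ 2) s := by
    have h1 : HasDerivAt (fun z : ℂ => z⁻¹) (-(s ^ 2)⁻¹) s := hasDerivAt_inv hs0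
    rw [neg_div, one_div]
    refine h1.congr_of_eventuallyEq ?_
    filter_upwards [(isOpen_lt continuous_const Complex.continuous_re).mem_nhds
      (show s ∈ {z : ℂ | 0 < z.re} from hs)] with z hz
    rw [hf, (hasMellin_one_Ioc hz).2, one_div]
  have heq := hderiv.unique hderiv'
  have h2 := hasMellin_const_smul hconv (-1 : ℂ)
  rw [heq] at h2
  have e : (-1 : ℂ) • (-(1 : ℂ) / s ^ 2) = 1 / s ^ 2 := by rw [smul_eq_mul]; ring
  rw [e] at h2
  refine h2.congr_Ioi fun x hx => ?_
  by_cases hx1 : x ≤ 1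
  · have hm : x ∈ Ioc (0 : ℝ) 1 := ⟨hx, hx1⟩
    rw [hf, indicator_of_mem hm, logCut_of_le hx hx1]
    simp
  · have hm : x ∉ Ioc (0 : ℝ) 1 := fun h => hx1 h.2
    rw [hf, indicator_of_notMem hm, logCut_of_ge (not_le.mp hx1).le]
    simp

lemma _root_.HasMellin.comp_inv_mul {f : ℝ → ℂ} {s m : ℂ} (h : HasMellin f s m) {a : ℝ}
    (ha : 0 < a) : HasMellin (fun x => f (a⁻¹ * x)) s ((a : ℂ) ^ s * m) := by
  refine ⟨(MellinConvergent.comp_mul_left (inv_pos.mpr ha)).mpr h.1, ?_⟩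
  rw [mellin_comp_mul_left f s (inv_pos.mpr ha), h.2, smul_eq_mul, Complex.ofReal_inv,
    Complex.inv_cpow _ _ (by rw [Complex.arg_ofReal_of_nonneg ha.le]; exact Real.pi_ne_zero.symm),
    Complex.cpow_neg, inv_inv]

/-- The Bose kernel `f(cx)` with its two leading terms at `0` removed by cut-offs whose Mellin
transforms vanish at the nonzero points of `(2πi / log a) ℤ`. -/
noncomputable def regBose (a c x : ℝ) : ℝ :=
  boseKernel 1 (c * x) - ((a - 1) * c)⁻¹ * (invCut (a⁻¹ * x) - invCut x)
    + (2 * Real.log a)⁻¹ * (logCut (a⁻¹ * x) - logCut x)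

variable {a c : ℝ}

/-- Here all cut-offs are active; their differences are (a - 1)/x and log a, and the prefactors in
`regBose` normalise these to 1/(cx) and 1/2. -/
lemma regBose_of_le_one (ha : 1 < a) (hc : 0 < c) {x : ℝ} (h0 : 0 < x) (h1 : x ≤ 1) :
    regBose a c x = boseKernel 1 (c * x) - 1 / (c * x) + 1 / 2 := by
  have ha0 : 0 < a := by linarith
  have ha1 : a - 1 ≠ 0 := by linarith
  have hL : Real.log a ≠ 0 := (Real.log_pos ha).ne'
  have hx0 : 0 < a⁻¹ * x := by positivity
  have hx1 : a⁻¹ * x ≤ 1 := mul_le_one₀ (inv_le_one_of_one_le₀ ha.le) h0.le h1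
  rw [regBose, invCut_of_le hx0 hx1, invCut_of_le h0 h1, logCut_of_le hx0 hx1,
    logCut_of_le h0 h1, Real.log_mul (inv_ne_zero ha0.ne') h0.ne', Real.log_inv]
  field_simp
  ring

/-- Together with the range (0, 1] this covers every sample point a^n; the shape of `regBose` on (1,
a) never enters the sampled sum. -/
lemma regBose_of_ge (ha : 1 < a) {x : ℝ} (h1 : a ≤ x) :
    regBose a c x = boseKernel 1 (c * x) := by
  have ha0 : 0 < a := by linarith
  have hx1 : 1 ≤ a⁻¹ * x := by
    rw [inv_mul_eq_div, le_div_iff₀ ha0, one_mul]; exact h1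
  rw [regBose, invCut_of_ge hx1, invCut_of_ge (ha.le.trans h1), logCut_of_ge hx1,
    logCut_of_ge (ha.le.trans h1)]
  ring

lemma continuousOn_regBose (ha : 1 < a) (hc : 0 < c) : ContinuousOn (regBose a c) (Ioi 0) := by
  have ha0 : 0 < a⁻¹ := by
    have : 0 < a := by linarith
    positivity
  have m1 : MapsTo (fun x : ℝ => c * x) (Ioi 0) (Ioi 0) := fun x hx => mul_pos hc hx
  have m2 : MapsTo (fun x : ℝ => a⁻¹ * x) (Ioi 0) (Ioi 0) := fun x hx => mul_pos ha0 hx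
  have c1 := (continuousOn_boseKernel 1).comp (continuous_const_mul c).continuousOn m1
  have c2 := continuousOn_invCut.comp (continuous_const_mul a⁻¹).continuousOn m2
  have c3 := continuousOn_logCut.comp (continuous_const_mul a⁻¹).continuousOn m2
  exact (c1.sub (continuousOn_const.mul (c2.sub continuousOn_invCut))).add
    (continuousOn_const.mul (c3.sub continuousOn_logCut))

lemma isBigO_regBose_zero (ha : 1 < a) (hc : 0 < c) :
    regBose a c =O[𝓝[>] 0] fun x => x := by
  refine IsBigO.of_bound (c * Real.exp c) ?_
  filter_upwards [Ioo_mem_nhdsGT (zero_lt_one : (0 : ℝ) < 1)] with x hx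
  have hx0 : 0 < x := hx.1
  rw [regBose_of_le_one ha hc hx0 hx.2.le, Real.norm_eq_abs, Real.norm_of_nonneg hx0.le]
  refine (abs_boseKernel_sub_le (mul_pos hc hx0)).trans ?_
  have : Real.exp (c * x) ≤ Real.exp c := Real.exp_le_exp.mpr (by nlinarith [hx.2])
  calc c * x * Real.exp (c * x) ≤ c * x * Real.exp c := by gcongr
    _ = c * Real.exp c * x := by ring

lemma isBigO_regBose_atTop (ha : 1 < a) (hc : 0 < c) :
    regBose a c =O[atTop] fun x => Real.exp (-c * x) := by
  have h1 := (isBigO_boseKernel_atTop 1).comp_tendsto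
    (tendsto_id.const_mul_atTop hc : Tendsto (fun x : ℝ => c * x) atTop atTop)
  refine (h1.congr' ?_ EventuallyEq.rfl).congr_right fun x => ?_
  · filter_upwards [eventually_ge_atTop a] with x hx
    exact (regBose_of_ge ha hx).symm
  · simp only [Function.comp]; congr 1; ring

lemma isBigO_regBose_zero_rpow (ha : 1 < a) (hc : 0 < c) :
    regBose a c =O[𝓝[>] 0] fun x => x ^ (-(-1 : ℝ)) := by
  simpa using isBigO_regBose_zero ha hc

lemma differentiableAt_mellin_regBose (ha : 1 < a) (hc : 0 < c) {s : ℂ} (hs : -1 < s.re) :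
    DifferentiableAt ℂ (mellin fun x => (regBose a c x : ℂ)) s :=
  mellin_differentiableAt_of_isBigO_rpow_exp hc
    (locallyIntegrableOn_ofReal (continuousOn_regBose ha hc))
    (isBigO_ofReal_left (isBigO_regBose_atTop ha hc))
    (isBigO_ofReal_left (isBigO_regBose_zero_rpow ha hc)) hs

lemma mellin_regBose_of_lt (ha : 1 < a) (hc : 0 < c) {s : ℂ} (hs : 1 < s.re) :
    mellin (fun x => (regBose a c x : ℂ)) s =
      (c : ℂ) ^ (-s) * (Complex.Gamma s * riemannZeta s)
        - ((a : ℂ) ^ s - 1) / ((a - 1) * c * (s * (s - 1)))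
        + ((a : ℂ) ^ s - 1) / (2 * (Real.log a : ℂ) * s ^ 2) := by
  have ha0 : 0 < a := by linarith
  have h1 : HasMellin (fun x => (boseKernel 1 (c * x) : ℂ)) s
      ((c : ℂ) ^ (-s) * (Complex.Gamma s * riemannZeta s)) := by
    have hk : MellinConvergent (fun x => (boseKernel 1 x : ℂ)) s :=
      mellinConvergent_boseKernel 1 (by simpa using hs)
    refine ⟨(MellinConvergent.comp_mul_left hc).mpr hk, ?_⟩
    rw [mellin_comp_mul_left (fun x => (boseKernel 1 x : ℂ)) s hc, mellin_boseKernel_one hs,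
      smul_eq_mul]
  have h2 := hasMellin_invCut hs
  have h2' := h2.comp_inv_mul ha0
  have h3 := hasMellin_logCut (s := s) (by linarith)
  have h3' := h3.comp_inv_mul ha0
  have h4 := hasMellin_sub h2'.1 h2.1
  have h5 := hasMellin_sub h3'.1 h3.1
  have h6 := hasMellin_const_smul h4.1 (((a : ℂ) - 1) * c)⁻¹
  have h7 := hasMellin_const_smul h5.1 (2 * (Real.log a : ℂ))⁻¹
  have h8 := hasMellin_sub h1.1 h6.1
  have h9 := hasMellin_add h8.1 h7.1
  have h10 := h9.congr_Ioi (g := fun x => (regBose a c x : ℂ)) fun x _ => by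
    simp [regBose]
  rw [h10.2, h8.2, h7.2, h5.2, h6.2, h4.2, h1.2, h2.2, h2'.2, h3.2, h3'.2]
  simp only [smul_eq_mul, div_eq_mul_inv, mul_inv]
  ring

/-- Analytic continuation of the Mellin transform of `regBose`, cleared of denominators. -/
lemma mul_mellin_regBose (ha : 1 < a) (hc : 0 < c) {s : ℂ} (hs : -1 < s.re) :
    s ^ 2 * (s - 1) * mellin (fun x => (regBose a c x : ℂ)) s =
      s * ((c : ℂ) ^ (-s) * gammaZeta s) - s * ((a : ℂ) ^ s - 1) / ((a - 1) * c)
        + (s - 1) * ((a : ℂ) ^ s - 1) / (2 * (Real.log a : ℂ)) := by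
  have ha0 : (a : ℂ) ≠ 0 := by
    have : a ≠ 0 := by linarith
    exact_mod_cast this
  have hc0 : (c : ℂ) ≠ 0 := by exact_mod_cast hc.ne'
  have ha1 : (a : ℂ) - 1 ≠ 0 := by
    have : a - 1 ≠ 0 := by linarith
    exact_mod_cast this
  have hL : (Real.log a : ℂ) ≠ 0 := by exact_mod_cast (Real.log_pos ha).ne'
  refine eq_of_eq_of_one_lt_re
    (F := fun s => s ^ 2 * (s - 1) * mellin (fun x => (regBose a c x : ℂ)) s)
    (G := fun s => s * ((c : ℂ) ^ (-s) * gammaZeta s) - s * ((a : ℂ) ^ s - 1) / ((a - 1) * c)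
        + (s - 1) * ((a : ℂ) ^ s - 1) / (2 * (Real.log a : ℂ))) ?_ ?_ ?_ hs
  · intro z hz
    have := differentiableAt_mellin_regBose ha hc hz
    fun_prop
  · intro z hz
    have h1 := differentiableAt_gammaZeta hz
    have h2 : DifferentiableAt ℂ (fun s : ℂ => (c : ℂ) ^ (-s)) z :=
      (differentiableAt_id.neg).const_cpow (Or.inl hc0)
    have h3 : DifferentiableAt ℂ (fun s : ℂ => (a : ℂ) ^ s) z :=
      differentiableAt_id.const_cpow (Or.inl ha0)
    fun_prop (disch := positivity)
  · intro z hz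
    have hz0 : z ≠ 0 := by rintro rfl; simp at hz; linarith
    have hz1 : z ≠ 1 := by rintro rfl; simp at hz
    have hz1' : z - 1 ≠ 0 := sub_ne_zero.mpr hz1
    rw [mellin_regBose_of_lt ha hc hz, gammaZeta_eq hz0 hz1]
    field_simp

end Compensators

/-! ### Values of the regularised Mellin transform at the Poisson frequencies. -/

section Values

open Filter Topology Asymptotics MeasureTheory Set

variable {a c : ℝ}

lemma mellin_regBose_of_cpow_eq_one (ha : 1 < a) (hc : 0 < c) {s : ℂ} (hs : s.re = 0)
    (hs0 : s ≠ 0) (has : (a : ℂ) ^ s = 1) :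
    mellin (fun x => (regBose a c x : ℂ)) s =
      (c : ℂ) ^ (-s) * (Complex.Gamma s * riemannZeta s) := by
  have hs1 : s ≠ 1 := by rintro rfl; simp at hs
  have hs1' : s - 1 ≠ 0 := sub_ne_zero.mpr hs1
  have h := mul_mellin_regBose ha hc (s := s) (by rw [hs]; norm_num)
  rw [has, gammaZeta_eq hs0 hs1] at h
  have h2 : s ^ 2 * (s - 1) ≠ 0 := mul_ne_zero (pow_ne_zero _ hs0) hs1'
  refine mul_left_cancel₀ h2 (h.trans ?_)
  ring

/-- The constants come from Γ'(1) = -γ, ζ(0) = -1/2 and ζ'(0) = -log(2π)/2. -/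
lemma hasDerivAt_gammaZeta_zero :
    HasDerivAt gammaZeta
      ((-(Real.eulerMascheroniConstant : ℂ)) / 2 + (-1 / 2 + Complex.log (2 * Real.pi) / 2)) 0 := by
  have h1 : HasDerivAt (fun s : ℂ => Complex.Gamma (s + 1))
      (-(Real.eulerMascheroniConstant : ℂ)) 0 := by
    have h := Complex.hasDerivAt_Gamma_one
    have h' : HasDerivAt Complex.Gamma (-(Real.eulerMascheroniConstant : ℂ)) (0 + 1) := by
      simpa using h
    exact h'.comp_add_const 0 1
  have h2 : HasDerivAt riemannZeta₁ (-1 / 2 + Complex.log (2 * Real.pi) / 2) 0 := by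
    have hz := (differentiableAt_riemannZeta (s := 0) zero_ne_one).hasDerivAt
    rw [deriv_riemannZeta_zero] at hz
    have hm := ((hasDerivAt_id (0 : ℂ)).sub_const 1).mul hz
    have hm' : HasDerivAt (fun s : ℂ => (s - 1) * riemannZeta s)
        (-1 / 2 + Complex.log (2 * Real.pi) / 2) 0 := by
      refine hm.congr_deriv ?_
      rw [riemannZeta_zero]
      simp
      ring
    refine hm'.congr_of_eventuallyEq ?_
    filter_upwards [isOpen_ne.mem_nhds (zero_ne_one : (0 : ℂ) ≠ 1)] with z hz1
    have : z - 1 ≠ 0 := sub_ne_zero.mpr hz1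
    rw [riemannZeta_eq_inv_sub_mul hz1]
    field_simp
  refine (h1.mul h2).congr_deriv ?_
  have : riemannZeta₁ 0 = 1 / 2 := by
    have := riemannZeta_eq_inv_sub_mul (s := 0) zero_ne_one
    rw [riemannZeta_zero, show ((0 : ℂ) - 1)⁻¹ = -1 by norm_num] at this
    linear_combination this
  simp [this]
  ring

lemma gammaZeta_zero : gammaZeta 0 = 1 / 2 := by
  have := riemannZeta_eq_inv_sub_mul (s := 0) zero_ne_one
  rw [riemannZeta_zero, show ((0 : ℂ) - 1)⁻¹ = -1 by norm_num] at this
  simp only [gammaZeta, zero_add, Complex.Gamma_one, one_mul]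
  linear_combination this

/-- Second order is needed because the logarithmic compensator contributes (a^s - 1)/s². -/
lemma tendsto_cexp_second_order (L : ℂ) :
    Tendsto (fun s : ℂ => (Complex.exp (L * s) - 1 - L * s) / s ^ 2) (𝓝[≠] 0) (𝓝 (L ^ 2 / 2)) := by
  have h1 := Complex.exp_sub_sum_range_succ_isLittleO_pow 2
  have ht : Tendsto (fun s : ℂ => L * s) (𝓝[≠] 0) (𝓝 0) := by
    have : ContinuousAt (fun s : ℂ => L * s) 0 := by fun_prop
    simpa using this.tendsto.mono_left nhdsWithin_le_nhds
  have h2 := h1.comp_tendsto ht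
  have h3 : (fun s : ℂ => (L * s) ^ 2) =O[𝓝[≠] 0] fun s => s ^ 2 := by
    simp_rw [mul_pow]
    exact isBigO_const_mul_self _ _ _
  have h4 := (h2.trans_isBigO h3).tendsto_div_nhds_zero
  have h5 := h4.add_const (L ^ 2 / 2)
  rw [zero_add] at h5
  refine h5.congr' ?_
  filter_upwards [self_mem_nhdsWithin] with s hs
  have hs0 : s ≠ 0 := hs
  simp [Finset.sum_range_succ]
  field_simp
  ring

lemma mellin_regBose_zero (ha : 1 < a) (hc : 0 < c) :
    mellin (fun x => (regBose a c x : ℂ)) 0 =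
      ((Real.eulerMascheroniConstant / 2 - Real.log (2 * Real.pi) / 2 + Real.log c / 2
        + Real.log a / (c * (a - 1)) + Real.log a / 4 : ℝ) : ℂ) := by
  have ha0 : (a : ℂ) ≠ 0 := by
    have : a ≠ 0 := by linarith
    exact_mod_cast this
  have hc0 : (c : ℂ) ≠ 0 := by exact_mod_cast hc.ne'
  have ha1 : (a : ℂ) - 1 ≠ 0 := by
    have : a - 1 ≠ 0 := by linarith
    exact_mod_cast this
  set L : ℂ := (Real.log a : ℂ) with hLdef
  have hL : L ≠ 0 := by
    rw [hLdef]
    exact_mod_cast (Real.log_pos ha).ne'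
  have hloga : Complex.log a = L := (Complex.ofReal_log (by linarith)).symm
  set M := mellin (fun x => (regBose a c x : ℂ)) with hM
  set B : ℂ → ℂ := fun s => (c : ℂ) ^ (-s) * gammaZeta s with hB
  set B' : ℂ := -Complex.log c / 2 + ((-(Real.eulerMascheroniConstant : ℂ)) / 2
    + (-1 / 2 + Complex.log (2 * Real.pi) / 2)) with hB'
  have hBd : HasDerivAt B B' 0 := by
    have h1 : HasDerivAt (fun s : ℂ => (c : ℂ) ^ (-s)) (-Complex.log c) 0 := by
      have := (hasDerivAt_neg (0 : ℂ)).const_cpow (c := (c : ℂ)) (Or.inl hc0)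
      simpa using this
    refine (h1.mul hasDerivAt_gammaZeta_zero).congr_deriv ?_
    rw [gammaZeta_zero, hB']
    simp
    ring
  have hB0 : B 0 = 1 / 2 := by simp [hB, gammaZeta_zero]
  have t1 : Tendsto (fun s : ℂ => (B s - 1 / 2) / s) (𝓝[≠] 0) (𝓝 B') := by
    refine (hasDerivAt_iff_tendsto_slope.mp hBd).congr fun s => ?_
    rw [slope_def_field, hB0, sub_zero]
  have t3 := tendsto_cexp_second_order L
  have hs : Tendsto (fun s : ℂ => s) (𝓝[≠] 0) (𝓝 0) := tendsto_id.mono_left nhdsWithin_le_nhds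
  have hexp : ∀ s : ℂ, (a : ℂ) ^ s = Complex.exp (L * s) := fun s => by
    rw [Complex.cpow_def_of_ne_zero ha0, hloga]
  have t2 : Tendsto (fun s : ℂ => (Complex.exp (L * s) - 1) / s) (𝓝[≠] 0) (𝓝 L) := by
    have := (t3.mul hs).add_const L
    rw [mul_zero, zero_add] at this
    refine this.congr' ?_
    filter_upwards [self_mem_nhdsWithin] with s hs0
    have hs0 : s ≠ 0 := hs0
    field_simp
    ring
  have hMc : Tendsto (fun s => (s - 1) * M s) (𝓝[≠] 0) (𝓝 ((0 - 1) * M 0)) := by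
    have h1 : ContinuousAt M 0 :=
      (differentiableAt_mellin_regBose ha hc (s := 0) (by simp)).continuousAt
    exact (hs.sub_const 1).mul (h1.tendsto.mono_left nhdsWithin_le_nhds)
  have hR := ((t1.sub (t2.div_const (((a : ℂ) - 1) * c))).add (t2.div_const (2 * L))).sub
    (t3.div_const (2 * L))
  -- This is the continued identity divided by s². The pole 1/(2s) from B(0) = 1/2 cancels the one
  -- from the linear term Ls of a^s - 1, so each grouped quotient has a finite limit.
  have hEq : ∀ᶠ s in 𝓝[≠] (0 : ℂ), (B s - 1 / 2) / s - (Complex.exp (L * s) - 1) / s /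
      (((a : ℂ) - 1) * c) + (Complex.exp (L * s) - 1) / s / (2 * L)
      - (Complex.exp (L * s) - 1 - L * s) / s ^ 2 / (2 * L) = (s - 1) * M s := by
    have hopen : ∀ᶠ s in 𝓝[≠] (0 : ℂ), -1 < s.re :=
      nhdsWithin_le_nhds (isOpen_re_gt_neg_one.mem_nhds (by simp))
    filter_upwards [self_mem_nhdsWithin, hopen] with s hs0 hre
    have hs0 : s ≠ 0 := hs0
    have key := mul_mellin_regBose ha hc hre
    rw [hexp, ← hLdef] at key
    have h2 : s ^ 2 ≠ 0 := pow_ne_zero _ hs0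
    refine mul_left_cancel₀ h2 ?_
    rw [← mul_assoc, key, hB]
    field_simp
    ring
  have huniq := tendsto_nhds_unique (hR.congr' hEq) hMc
  have hlog2pi : Complex.log (2 * Real.pi) = (Real.log (2 * Real.pi) : ℂ) := by
    rw [Complex.ofReal_log (by positivity)]; push_cast; rfl
  have hlogc : Complex.log c = (Real.log c : ℂ) := (Complex.ofReal_log hc.le).symm
  rw [hB', hlog2pi, hlogc] at huniq
  have : M 0 = -((0 - 1) * M 0) := by ring
  rw [this, ← huniq]
  push_cast
  rw [← hLdef]
  field_simp
  ring

end Values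

/-! ### Absolute convergence and the master identity. -/

section Master

open Filter Topology

variable {a c : ℝ}

lemma imagPole_eq (a : ℝ) (k : ℕ) :
    imagPole a k = ((2 * Real.pi * k / Real.log a : ℝ) : ℂ) * Complex.I := by
  unfold imagPole; push_cast; ring

lemma imagPole_re (a : ℝ) (k : ℕ) : (imagPole a k).re = 0 := by
  rw [imagPole_eq, Complex.re_ofReal_mul, Complex.I_re, mul_zero]

lemma norm_imagPole (ha : 1 < a) (k : ℕ) :
    ‖imagPole a k‖ = 2 * Real.pi / Real.log a * k := by
  have := Real.log_pos ha
  have := Real.pi_pos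
  rw [imagPole_eq, norm_mul, Complex.norm_I, mul_one, Complex.norm_real,
    Real.norm_of_nonneg (by positivity)]
  ring

lemma imagPole_ne_zero (ha : 1 < a) (k : ℕ) : imagPole a (k + 1) ≠ 0 := by
  rw [← norm_pos_iff, norm_imagPole ha]
  have := Real.log_pos ha
  have := Real.pi_pos
  positivity

lemma conj_imagPole (a : ℝ) (k : ℕ) : (starRingEnd ℂ) (imagPole a k) = -imagPole a k := by
  rw [imagPole_eq, map_mul, Complex.conj_ofReal, Complex.conj_I, mul_neg]

lemma cpow_imagPole (ha : 1 < a) (k : ℕ) : (a : ℂ) ^ imagPole a k = 1 := by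
  have ha0 : (a : ℂ) ≠ 0 := by
    have : a ≠ 0 := by linarith
    exact_mod_cast this
  have hL : (Real.log a : ℂ) ≠ 0 := by exact_mod_cast (Real.log_pos ha).ne'
  rw [Complex.cpow_def_of_ne_zero ha0, ← Complex.ofReal_log (by linarith), imagPole,
    mul_div_cancel₀ _ hL, Complex.exp_eq_one_iff]
  exact ⟨k, by push_cast; ring⟩

lemma cpow_neg_imagPole (ha : 1 < a) (k : ℕ) : (a : ℂ) ^ (-imagPole a k) = 1 := by
  rw [Complex.cpow_neg, cpow_imagPole ha, inv_one]

/-- On the imaginary axis |c^(-s)| = 1 and |s| ≤ |s - 1|, so the bound on s(s-1)Γ(s)ζ(s) gives terms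
at most C/|s|², with |s| proportional to k + 1. -/
lemma summable_cpow_mul_Gamma_mul_riemannZeta (ha : 1 < a) (hc : 0 < c) :
    Summable fun k : ℕ => (c : ℂ) ^ (-imagPole a (k + 1)) *
      (Complex.Gamma (imagPole a (k + 1)) * riemannZeta (imagPole a (k + 1))) := by
  obtain ⟨C, hC⟩ := exists_norm_gammaZeta_le
  have hL := Real.log_pos ha
  have hpi := Real.pi_pos
  have hsum : Summable fun k : ℕ => C / (2 * Real.pi / Real.log a) ^ 2 * (1 / ((k : ℝ) + 1) ^ 2) := by
    have h := (summable_nat_add_iff 1).mpr (Real.summable_one_div_nat_pow.mpr one_lt_two)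
    exact (h.congr fun k => by push_cast; rfl).mul_left _
  refine Summable.of_norm_bounded hsum fun k => ?_
  set s := imagPole a (k + 1) with hs
  have hre : s.re = 0 := imagPole_re a _
  have hs0 : s ≠ 0 := imagPole_ne_zero ha k
  have hs1 : s ≠ 1 := by intro h; rw [h] at hre; simp at hre
  have hs1' : s - 1 ≠ 0 := sub_ne_zero.mpr hs1
  have h1 : ‖(c : ℂ) ^ (-s)‖ = 1 := by
    rw [Complex.norm_cpow_eq_rpow_re_of_pos hc, Complex.neg_re, hre, neg_zero, Real.rpow_zero]
  have h2 : ‖s‖ ≤ ‖s - 1‖ := by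
    rw [← sq_le_sq₀ (norm_nonneg _) (norm_nonneg _), Complex.sq_norm, Complex.sq_norm,
      Complex.normSq_apply, Complex.normSq_apply]
    simp [hre]
  have hpos : 0 < ‖s‖ := norm_pos_iff.mpr hs0
  rw [norm_mul, h1, one_mul]
  have h3 : ‖s‖ * ‖s - 1‖ * ‖Complex.Gamma s * riemannZeta s‖ ≤ C := by
    have := hC s hre
    rwa [gammaZeta_eq hs0 hs1, norm_mul, norm_mul] at this
  have h4 : ‖s‖ ^ 2 * ‖Complex.Gamma s * riemannZeta s‖ ≤ C := by
    refine le_trans ?_ h3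
    rw [sq]
    gcongr
  have h5 : ‖Complex.Gamma s * riemannZeta s‖ ≤ C / ‖s‖ ^ 2 := by
    rw [le_div_iff₀ (by positivity), mul_comm]; exact h4
  refine h5.trans_eq ?_
  rw [hs, norm_imagPole ha, mul_pow]
  push_cast
  field_simp

lemma boseKernel_one_le {x : ℝ} (hx : 0 < x) : boseKernel 1 x ≤ 1 / x := by
  refine (boseKernel_le 1 hx).trans ?_
  rw [pow_one, ← mul_div_assoc]
  gcongr
  have h1 : 1 + x ≤ Real.exp x := by linarith [Real.add_one_le_exp x]
  calc Real.exp (-x) * (1 + x) ≤ Real.exp (-x) * Real.exp x := by gcongr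
    _ = 1 := by rw [← Real.exp_add]; simp

lemma summable_boseKernel_mul_pow (ha : 1 < a) (hc : 0 < c) :
    Summable fun n : ℕ => boseKernel 1 (c * a ^ n) := by
  have ha0 : 0 < a := by linarith
  have hg : Summable fun n : ℕ => c⁻¹ * (a⁻¹) ^ n :=
    (summable_geometric_of_lt_one (by positivity) (inv_lt_one_of_one_lt₀ ha)).mul_left _
  refine Summable.of_nonneg_of_le (fun n => boseKernel_nonneg 1 (by positivity)) (fun n => ?_) hg
  refine (boseKernel_one_le (by positivity)).trans_eq ?_
  rw [one_div, mul_inv, inv_pow]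

lemma summable_boseKernel_sub (ha : 1 < a) (hc : 0 < c) :
    Summable fun n : ℕ => boseKernel 1 (c * (a ^ (n + 1))⁻¹) - a ^ (n + 1) / c + 1 / 2 := by
  have ha0 : 0 < a := by linarith
  have hg : Summable fun n : ℕ => c * Real.exp c * (a⁻¹) ^ n :=
    (summable_geometric_of_lt_one (by positivity) (inv_lt_one_of_one_lt₀ ha)).mul_left _
  refine Summable.of_norm_bounded hg fun n => ?_
  have hy : 0 < c * (a ^ (n + 1))⁻¹ := by positivity
  have e : a ^ (n + 1) / c = 1 / (c * (a ^ (n + 1))⁻¹) := by field_simp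
  rw [e, Real.norm_eq_abs]
  refine (abs_boseKernel_sub_le hy).trans ?_
  have h1 : (a ^ (n + 1))⁻¹ ≤ 1 := inv_le_one_of_one_le₀ (one_le_pow₀ ha.le)
  have h2 : (a ^ (n + 1))⁻¹ ≤ (a⁻¹) ^ n := by
    rw [inv_pow]
    exact inv_anti₀ (by positivity) (pow_le_pow_right₀ ha.le (Nat.le_succ n))
  calc c * (a ^ (n + 1))⁻¹ * Real.exp (c * (a ^ (n + 1))⁻¹)
      ≤ c * (a⁻¹) ^ n * Real.exp c := by
        gcongr
        nlinarith
    _ = c * Real.exp c * (a⁻¹) ^ n := by ring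

/-- The master identity for the geometric sampling of the Bose kernel. -/
theorem tsum_boseKernel_mul_pow (ha : 1 < a) (hc : 0 < c) :
    ∑' n : ℕ, boseKernel 1 (c * a ^ n) =
      a / (c * (a - 1)) - 1 / 4
      + (Real.eulerMascheroniConstant - Real.log (2 * Real.pi) + Real.log c) / (2 * Real.log a)
      - ∑' n : ℕ, (boseKernel 1 (c * (a ^ (n + 1))⁻¹) - a ^ (n + 1) / c + 1 / 2)
      + 2 / Real.log a * (∑' k : ℕ, (c : ℂ) ^ (-imagPole a (k + 1)) *
        (Complex.Gamma (imagPole a (k + 1)) * riemannZeta (imagPole a (k + 1)))).re := by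
  have ha0 : 0 < a := by linarith
  have hL := Real.log_pos ha
  have hLc : (Real.log a : ℂ) ≠ 0 := by exact_mod_cast hL.ne'
  set L := Real.log a with hLdef
  set M : ℂ → ℂ := mellin (fun x => (regBose a c x : ℂ)) with hM
  set z : ℕ → ℂ := fun k => (c : ℂ) ^ (-imagPole a (k + 1)) *
        (Complex.Gamma (imagPole a (k + 1)) * riemannZeta (imagPole a (k + 1))) with hz
  set g : ℤ → ℂ := fun k => M (2 * Real.pi * Complex.I * k / L) with hg
  have hgpos : ∀ k : ℕ, g ((k : ℤ) + 1) = z k := by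
    intro k
    have e : (2 * Real.pi * Complex.I * (((k : ℤ) + 1 : ℤ) : ℂ) / L : ℂ) = imagPole a (k + 1) := by
      rw [imagPole, ← hLdef]; push_cast; rfl
    simp only [hg, hM, hz]
    rw [e]
    exact mellin_regBose_of_cpow_eq_one ha hc (imagPole_re a _) (imagPole_ne_zero ha k)
      (cpow_imagPole ha _)
  -- The negative frequency is the conjugate pole, and c^(-s), Γ and ζ all commute with conjugation.
  have hgneg : ∀ k : ℕ, g (-((k : ℤ) + 1)) = (starRingEnd ℂ) (z k) := by
    intro k
    have e : (2 * Real.pi * Complex.I * ((-((k : ℤ) + 1) : ℤ) : ℂ) / L : ℂ)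
        = (starRingEnd ℂ) (imagPole a (k + 1)) := by
      rw [conj_imagPole, imagPole, ← hLdef]; push_cast; ring
    simp only [hg, hM, hz]
    rw [e, map_mul, map_mul, ← Complex.Gamma_conj, ← riemannZeta_conj]
    have e2 : (starRingEnd ℂ) ((c : ℂ) ^ (-imagPole a (k + 1)))
        = (c : ℂ) ^ (-(starRingEnd ℂ) (imagPole a (k + 1))) := by
      rw [← map_neg, Complex.cpow_conj _ _ (by
        rw [Complex.arg_ofReal_of_nonneg hc.le]; exact Real.pi_ne_zero.symm), Complex.conj_ofReal]
    rw [e2]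
    refine mellin_regBose_of_cpow_eq_one ha hc (by rw [Complex.conj_re, imagPole_re]) ?_ ?_
    · rw [conj_imagPole]; exact neg_ne_zero.mpr (imagPole_ne_zero ha k)
    · rw [conj_imagPole, cpow_neg_imagPole ha]
  have hzs : Summable z := summable_cpow_mul_Gamma_mul_riemannZeta ha hc
  have hzs' : Summable fun k => (starRingEnd ℂ) (z k) :=
    (Complex.hasSum_conj'.mpr (by simpa using hzs.hasSum)).summable
  have hgs1 : Summable fun k : ℕ => g k := by
    refine (summable_nat_add_iff 1).mp (hzs.congr fun k => ?_)
    rw [← hgpos]; push_cast; rfl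
  have hgs2 : Summable fun k : ℕ => g (-((k : ℤ) + 1)) := hzs'.congr fun k => (hgneg k).symm
  have hgs : Summable g := Summable.of_nat_of_neg_add_one hgs1 hgs2
  have hgsum : ∑' k : ℤ, g k = M 0 + ((2 * (∑' k, z k).re : ℝ) : ℂ) := by
    rw [tsum_of_nat_of_neg_add_one hgs1 hgs2, hgs1.tsum_eq_zero_add]
    have h1 : ∑' k : ℕ, g ((k + 1 : ℕ) : ℤ) = ∑' k, z k :=
      tsum_congr fun k => by rw [← hgpos]; push_cast; rfl
    have h2 : ∑' k : ℕ, g (-((k : ℤ) + 1)) = (starRingEnd ℂ) (∑' k, z k) := by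
      rw [Complex.conj_tsum]; exact tsum_congr hgneg
    have h0 : g ((0 : ℕ) : ℤ) = M 0 := by simp [hg]
    rw [h1, h2, h0, add_assoc, Complex.add_conj]
  have hpoisson := tsum_exp_mul_eq_tsum_mellin (p := fun x => (regBose a c x : ℂ)) hL
    (Complex.continuous_ofReal.comp_continuousOn (continuousOn_regBose ha hc))
    (isBigO_ofReal_left (isBigO_regBose_zero ha hc))
    (isBigO_ofReal_left ((isBigO_regBose_atTop ha hc).trans (by
      have := (isLittleO_exp_neg_mul_rpow_atTop hc (-1)).isBigO
      simpa [Real.rpow_neg_one] using this))) hgs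
  set q : ℤ → ℝ := fun n => regBose a c (Real.exp (L * n)) with hq
  have hexp : ∀ n : ℕ, Real.exp (L * ((n : ℕ) : ℤ)) = a ^ n := by
    intro n
    rw [mul_comm, Int.cast_natCast, Real.exp_nat_mul, hLdef, Real.exp_log ha0]
  have hexp' : ∀ n : ℕ, Real.exp (L * ((-((n : ℤ) + 1) : ℤ) : ℝ)) = (a ^ (n + 1))⁻¹ := by
    intro n
    rw [← hexp, ← Real.exp_neg]
    congr 1; push_cast; ring
  -- The sample x = 1 lies in the compensated range, so n = 0 leaves an extra -1/c + 1/2 next to the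
  -- wanted term.
  have hq0 : q ((0 : ℕ) : ℤ) = boseKernel 1 (c * a ^ 0) - 1 / c + 1 / 2 := by
    simp only [hq]
    rw [hexp, pow_zero, regBose_of_le_one ha hc one_pos le_rfl, mul_one]
  have hqpos : ∀ n : ℕ, q ((n + 1 : ℕ) : ℤ) = boseKernel 1 (c * a ^ (n + 1)) := by
    intro n
    simp only [hq]
    rw [hexp, regBose_of_ge ha (le_self_pow₀ ha.le n.succ_ne_zero)]
  have hqneg : ∀ n : ℕ, q (-((n : ℤ) + 1)) =
      boseKernel 1 (c * (a ^ (n + 1))⁻¹) - a ^ (n + 1) / c + 1 / 2 := by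
    intro n
    simp only [hq]
    rw [hexp', regBose_of_le_one ha hc (by positivity)
      (inv_le_one_of_one_le₀ (one_le_pow₀ ha.le))]
    field_simp
  have hf := summable_boseKernel_mul_pow ha hc
  have hr := summable_boseKernel_sub ha hc
  have hqs1 : Summable fun n : ℕ => q n := by
    refine (summable_nat_add_iff 1).mp ?_
    exact ((summable_nat_add_iff 1).mpr hf).congr fun n => (hqpos n).symm
  have hqs2 : Summable fun n : ℕ => q (-((n : ℤ) + 1)) := hr.congr fun n => (hqneg n).symm
  have hqsum : ∑' n : ℤ, q n = ∑' n : ℕ, boseKernel 1 (c * a ^ n) - 1 / c + 1 / 2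
      + ∑' n : ℕ, (boseKernel 1 (c * (a ^ (n + 1))⁻¹) - a ^ (n + 1) / c + 1 / 2) := by
    rw [tsum_of_nat_of_neg_add_one hqs1 hqs2, hqs1.tsum_eq_zero_add, tsum_congr hqpos,
      tsum_congr hqneg, hq0, hf.tsum_eq_zero_add]
    ring
  have hfinal : ((∑' n : ℤ, q n : ℝ) : ℂ) = (L : ℂ)⁻¹ * ∑' k : ℤ, g k := by
    rw [Complex.ofReal_tsum]; exact hpoisson
  rw [hgsum, hM, mellin_regBose_zero ha hc] at hfinal
  have hreal : ∑' n : ℤ, q n = L⁻¹ * (Real.eulerMascheroniConstant / 2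
      - Real.log (2 * Real.pi) / 2 + Real.log c / 2 + L / (c * (a - 1)) + L / 4
      + 2 * (∑' k, z k).re) := by
    exact_mod_cast hfinal
  rw [hqsum] at hreal
  have ha1 : a - 1 ≠ 0 := by linarith
  have hval : L⁻¹ * (Real.eulerMascheroniConstant / 2
      - Real.log (2 * Real.pi) / 2 + Real.log c / 2 + L / (c * (a - 1)) + L / 4
      + 2 * (∑' k, z k).re) = (Real.eulerMascheroniConstant - Real.log (2 * Real.pi)
        + Real.log c) / (2 * L) + 1 / (c * (a - 1)) + 1 / 4 + 2 / L * (∑' k, z k).re := by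
    field_simp
  -- The 1/c left by n = 0 merges with the zero-frequency term 1/(c(a - 1)).
  have hval2 : a / (c * (a - 1)) = 1 / c + 1 / (c * (a - 1)) := by
    field_simp; ring
  rw [hval] at hreal
  rw [hval2]
  linarith

end Master

/-! ### Taylor expansion of the Bose kernel and zeta values at negative odd integers. -/

section Taylor

/-- The partial fraction series of π cot(πx) at x = iy/(2π), where e^(2πix) = e^(-y). -/
lemma boseKernel_eq_tsum {y : ℝ} (hy : 0 < y) :
    boseKernel 1 y - 1 / y + 1 / 2 =
      ∑' m : ℕ, 2 * y / (y ^ 2 + (2 * Real.pi * ((m : ℝ) + 1)) ^ 2) := by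
  have hpi := Real.pi_pos
  have hpic : (Real.pi : ℂ) ≠ 0 := by exact_mod_cast hpi.ne'
  have hyc : (y : ℂ) ≠ 0 := by exact_mod_cast hy.ne'
  set x : ℂ := ((y / (2 * Real.pi) : ℝ) : ℂ) * Complex.I with hx
  have hx' : x = y / (2 * Real.pi) * Complex.I := by rw [hx]; push_cast; rfl
  have him : x.im = y / (2 * Real.pi) := by rw [hx, Complex.im_ofReal_mul, Complex.I_im, mul_one]
  have himpos : 0 < x.im := by rw [him]; positivity
  have hmem : x ∈ Complex.integerComplement := by
    rintro ⟨n, hn⟩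
    rw [← hn] at himpos
    simp at himpos
  have h := cot_series_rep' hmem
  have hterm : ∀ m : ℕ, 1 / (x - ((m : ℂ) + 1)) + 1 / (x + ((m : ℂ) + 1)) =
      (-2 * Real.pi * Complex.I) *
        ((2 * y / (y ^ 2 + (2 * Real.pi * ((m : ℝ) + 1)) ^ 2) : ℝ) : ℂ) := by
    intro m
    have h1 : x - ((m : ℂ) + 1) ≠ 0 := by
      intro h0
      have := congrArg Complex.im h0
      simp at this
      rw [this] at himpos
      exact lt_irrefl _ himpos
    have h2 : x + ((m : ℂ) + 1) ≠ 0 := by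
      intro h0
      have := congrArg Complex.im h0
      simp at this
      rw [this] at himpos
      exact lt_irrefl _ himpos
    have h3 : (y : ℂ) ^ 2 + (2 * Real.pi * ((m : ℂ) + 1)) ^ 2 ≠ 0 := by
      have : y ^ 2 + (2 * Real.pi * ((m : ℝ) + 1)) ^ 2 ≠ 0 := by positivity
      exact_mod_cast this
    push_cast
    rw [div_add_div _ _ h1 h2, mul_div_assoc', div_eq_div_iff (mul_ne_zero h1 h2) h3]
    rw [hx']
    field_simp
    ring_nf
    simp only [Complex.I_pow_three]
    ring
  simp_rw [hterm] at h
  rw [tsum_mul_left, ← Complex.ofReal_tsum, Complex.cot_eq_exp_ratio] at h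
  have hexp : Complex.exp (2 * Complex.I * (Real.pi * x)) = (Real.exp (-y) : ℂ) := by
    rw [Complex.ofReal_exp, hx']
    congr 1
    push_cast
    field_simp
    rw [Complex.I_sq]
  rw [hexp] at h
  have hr : 1 - (Real.exp (-y) : ℂ) ≠ 0 := by
    have := (one_sub_exp_neg_pos hy).ne'
    exact_mod_cast this
  have hI := Complex.I_ne_zero
  have h2 : (-2 * Real.pi * Complex.I) * ((boseKernel 1 y - 1 / y + 1 / 2 : ℝ) : ℂ) =
      (-2 * Real.pi * Complex.I) *
      ((∑' m : ℕ, 2 * y / (y ^ 2 + (2 * Real.pi * ((m : ℝ) + 1)) ^ 2) : ℝ) : ℂ) := by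
    rw [← h, boseKernel, hx']
    push_cast at hr ⊢
    generalize Complex.exp (-(y : ℂ)) = r at *
    field_simp
    simp only [Complex.I_sq]
    ring
  have h3 := mul_left_cancel₀
    (mul_ne_zero (mul_ne_zero (by norm_num) hpic) hI : (-2 * Real.pi * Complex.I : ℂ) ≠ 0) h2
  exact_mod_cast h3

/-- `∑ 1 / m^(2k+2)`. -/
noncomputable def evenZeta (k : ℕ) : ℝ := ∑' m : ℕ, 1 / ((m : ℝ) + 1) ^ (2 * k + 2)

lemma summable_evenZeta (k : ℕ) : Summable fun m : ℕ => 1 / ((m : ℝ) + 1) ^ (2 * k + 2) := by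
  have h := (summable_nat_add_iff 1).mpr
    (Real.summable_one_div_nat_pow.mpr (show 1 < 2 * k + 2 by omega))
  exact h.congr fun m => by push_cast; rfl

lemma evenZeta_nonneg (k : ℕ) : 0 ≤ evenZeta k := tsum_nonneg fun m => by positivity

lemma evenZeta_le (k : ℕ) : evenZeta k ≤ evenZeta 0 := by
  refine (summable_evenZeta k).tsum_le_tsum (fun m => ?_) (summable_evenZeta 0)
  refine one_div_le_one_div_of_le (by positivity) (pow_le_pow_right₀ ?_ (by omega))
  linarith [(Nat.cast_nonneg m : (0 : ℝ) ≤ m)]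

/-- The Taylor coefficients of the Bose kernel. -/
noncomputable def boseCoeff (k : ℕ) : ℝ :=
  2 * (-1) ^ k / (2 * Real.pi) ^ (2 * k + 2) * evenZeta k

/-- A crude bound suffices: the expansion is used only for y ≤ 1, well inside its radius 2π. -/
lemma four_pow_le_two_pi_pow (k : ℕ) : (4 : ℝ) ^ k ≤ (2 * Real.pi) ^ (2 * k + 2) := by
  have h1 : (2 : ℝ) ≤ 2 * Real.pi := by linarith [Real.pi_gt_three]
  calc (4 : ℝ) ^ k = 2 ^ (2 * k) := by rw [pow_mul]; norm_num
    _ ≤ (2 * Real.pi) ^ (2 * k) := by gcongr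
    _ ≤ (2 * Real.pi) ^ (2 * k + 2) := pow_le_pow_right₀ (by linarith) (by omega)

lemma abs_boseCoeff_le (k : ℕ) : |boseCoeff k| ≤ 2 * evenZeta 0 * (1 / 4) ^ k := by
  have hpi := Real.pi_pos
  rw [boseCoeff, abs_mul, abs_div, abs_mul, abs_pow, abs_neg, abs_one, one_pow, mul_one,
    abs_of_nonneg (evenZeta_nonneg k), abs_of_pos (by positivity : (0 : ℝ) < 2),
    abs_of_pos (by positivity : 0 < (2 * Real.pi) ^ (2 * k + 2))]
  calc 2 / (2 * Real.pi) ^ (2 * k + 2) * evenZeta k ≤ 2 / 4 ^ k * evenZeta 0 := by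
        gcongr
        · exact evenZeta_nonneg k
        · exact four_pow_le_two_pi_pow k
        · exact evenZeta_le k
    _ = 2 * evenZeta 0 * (1 / 4) ^ k := by rw [one_div, inv_pow]; ring

/-- Each partial fraction is a geometric series in -(y/(2π(m+1)))²; interchanging the two sums
collects the even zeta values. -/
lemma boseKernel_eq_tsum_boseCoeff {y : ℝ} (hy : 0 < y) (hy1 : y ≤ 1) :
    boseKernel 1 y - 1 / y + 1 / 2 = ∑' k : ℕ, boseCoeff k * y ^ (2 * k + 1) := by
  have hpi := Real.pi_pos
  set F : ℕ → ℕ → ℝ := fun m k =>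
    2 * (-1) ^ k / (2 * Real.pi) ^ (2 * k + 2) * (1 / ((m : ℝ) + 1) ^ (2 * k + 2))
      * y ^ (2 * k + 1) with hF
  have hgeom : ∀ m : ℕ, ∑' k, F m k = 2 * y / (y ^ 2 + (2 * Real.pi * ((m : ℝ) + 1)) ^ 2) := by
    intro m
    have hd : 0 < 2 * Real.pi * ((m : ℝ) + 1) := by positivity
    set d := 2 * Real.pi * ((m : ℝ) + 1) with hd'
    have hyd : y < d := by
      have h3 := Real.pi_gt_three
      have hm : (0 : ℝ) ≤ m := Nat.cast_nonneg m
      rw [hd']; nlinarith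
    have hr : ‖-(y ^ 2 / d ^ 2)‖ < 1 := by
      rw [norm_neg, Real.norm_of_nonneg (by positivity), div_lt_one (by positivity)]
      exact pow_lt_pow_left₀ hyd hy.le two_ne_zero
    have h1 := (hasSum_geometric_of_norm_lt_one hr).mul_left (2 * y / d ^ 2)
    have h2 : ∀ k, F m k = 2 * y / d ^ 2 * (-(y ^ 2 / d ^ 2)) ^ k := by
      intro k
      simp only [hF]
      rw [neg_pow (y ^ 2 / d ^ 2) k, div_pow, ← pow_mul, ← pow_mul, hd', mul_pow _ _ 2, mul_pow _ _ (2 * k)]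
      field_simp
      ring
    have h3 : 1 - -(y ^ 2 / d ^ 2) = (y ^ 2 + d ^ 2) / d ^ 2 := by field_simp; ring
    rw [tsum_congr h2, h1.tsum_eq, h3, inv_div]
    field_simp
  have hsum : Summable (Function.uncurry F) := by
    have hg : Summable fun k : ℕ => 2 * (1 / 4 : ℝ) ^ k :=
      (summable_geometric_of_lt_one (by norm_num) (by norm_num)).mul_left 2
    have hprod := (summable_evenZeta 0).mul_of_nonneg hg (fun m => by positivity)
      (fun k => by positivity)
    refine Summable.of_norm_bounded hprod fun mk => ?_
    obtain ⟨m, k⟩ := mk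
    simp only [Function.uncurry, hF, norm_mul, norm_div, norm_pow, norm_neg, norm_one, one_pow,
      mul_one]
    rw [Real.norm_of_nonneg hy.le, Real.norm_of_nonneg (by positivity : (0 : ℝ) ≤ 2),
      Real.norm_of_nonneg (by positivity : (0 : ℝ) ≤ Real.pi),
      Real.norm_of_nonneg (by positivity : (0 : ℝ) ≤ (m : ℝ) + 1)]
    have h1 : (1 : ℝ) ≤ (m : ℝ) + 1 := by linarith [(Nat.cast_nonneg m : (0 : ℝ) ≤ m)]
    calc 2 / (2 * Real.pi) ^ (2 * k + 2) * (1 / ((m : ℝ) + 1) ^ (2 * k + 2)) * y ^ (2 * k + 1)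
        ≤ 2 / 4 ^ k * (1 / ((m : ℝ) + 1) ^ (2 * 0 + 2)) * 1 := by
          refine mul_le_mul (mul_le_mul ?_ ?_ (by positivity) (by positivity))
            (pow_le_one₀ hy.le hy1) (by positivity) (by positivity)
          · exact div_le_div_of_nonneg_left (by norm_num) (by positivity)
              (four_pow_le_two_pi_pow k)
          · exact one_div_le_one_div_of_le (by positivity) (pow_le_pow_right₀ h1 (by omega))
      _ = 1 / ((m : ℝ) + 1) ^ (2 * 0 + 2) * (2 * (1 / 4) ^ k) := by
          rw [one_div (4 : ℝ), inv_pow]; ring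
  rw [boseKernel_eq_tsum hy, ← tsum_congr hgeom, ← hsum.tsum_comm]
  refine tsum_congr fun k => ?_
  simp only [hF, boseCoeff, evenZeta]
  rw [tsum_mul_right, tsum_mul_left]

/-- Expanding each remainder at y = a^(-(n+1)) and summing over n first turns every power into a
geometric series with sum 1/(a^(2k+1) - 1). -/
lemma hasSum_boseCoeff_div {a : ℝ} (ha : 1 < a) :
    HasSum (fun k : ℕ => boseCoeff k / (a ^ (2 * k + 1) - 1))
      (∑' n : ℕ, (boseKernel 1 (a ^ (n + 1))⁻¹ - a ^ (n + 1) + 1 / 2)) := by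
  have ha0 : 0 < a := by linarith
  set F : ℕ → ℕ → ℝ := fun n k => boseCoeff k * ((a ^ (n + 1))⁻¹) ^ (2 * k + 1) with hF
  have hai : a⁻¹ < 1 := inv_lt_one_of_one_lt₀ ha
  have hrow : ∀ n : ℕ, ∑' k, F n k = boseKernel 1 (a ^ (n + 1))⁻¹ - a ^ (n + 1) + 1 / 2 := by
    intro n
    rw [← boseKernel_eq_tsum_boseCoeff (by positivity)
      (inv_le_one_of_one_le₀ (one_le_pow₀ ha.le)), one_div, inv_inv]
  have hcol : ∀ k : ℕ, ∑' n, F n k = boseCoeff k / (a ^ (2 * k + 1) - 1) := by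
    intro k
    simp only [hF]
    have hp : 1 < a ^ (2 * k + 1) := one_lt_pow₀ ha (by omega)
    set b := a ^ (2 * k + 1) with hb
    have hb0 : 0 < b := by linarith
    have h1 : ∀ n : ℕ, ((a ^ (n + 1))⁻¹) ^ (2 * k + 1) = b⁻¹ * b⁻¹ ^ n := by
      intro n
      rw [inv_pow, ← pow_mul, mul_comm, pow_mul, ← hb, pow_succ, mul_inv, inv_pow, mul_comm]
    rw [tsum_mul_left, tsum_congr h1, tsum_mul_left,
      tsum_geometric_of_lt_one (by positivity) (inv_lt_one_of_one_lt₀ hp)]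
    have : b - 1 ≠ 0 := by linarith
    have h2 : 1 - b⁻¹ ≠ 0 := by
      have := inv_lt_one_of_one_lt₀ hp
      linarith
    field_simp
  have hsum : Summable (Function.uncurry F) := by
    have hg : Summable fun k : ℕ => 2 * evenZeta 0 * (1 / 4 : ℝ) ^ k :=
      (summable_geometric_of_lt_one (by norm_num) (by norm_num)).mul_left _
    have hg' : Summable fun n : ℕ => (a⁻¹) ^ n :=
      summable_geometric_of_lt_one (by positivity) hai
    have h0 := evenZeta_nonneg 0
    have hprod := hg'.mul_of_nonneg hg (fun m => by positivity) (fun k => by positivity)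
    refine Summable.of_norm_bounded hprod fun nk => ?_
    obtain ⟨n, k⟩ := nk
    simp only [Function.uncurry, hF]
    rw [norm_mul, Real.norm_eq_abs, mul_comm, Real.norm_of_nonneg (by positivity)]
    have hle1 : (a ^ (n + 1))⁻¹ ≤ 1 := inv_le_one_of_one_le₀ (one_le_pow₀ ha.le)
    have h2 : ((a ^ (n + 1))⁻¹) ^ (2 * k + 1) ≤ (a⁻¹) ^ n := by
      calc ((a ^ (n + 1))⁻¹) ^ (2 * k + 1) ≤ ((a ^ (n + 1))⁻¹) ^ 1 :=
            pow_le_pow_of_le_one (by positivity) hle1 (by omega)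
        _ ≤ (a⁻¹) ^ n := by
            rw [pow_one, inv_pow]
            exact inv_anti₀ (by positivity) (pow_le_pow_right₀ ha.le (Nat.le_succ n))
    exact mul_le_mul h2 (abs_boseCoeff_le k) (abs_nonneg _) (by positivity)
  have hs := hsum.prod_symm.prod.hasSum
  have e1 : (fun k : ℕ => ∑' n : ℕ, Function.uncurry F (Prod.swap (k, n)))
      = fun k => boseCoeff k / (a ^ (2 * k + 1) - 1) := funext hcol
  rw [← tsum_congr hrow, ← hsum.tsum_comm, tsum_congr hcol, ← e1]
  exact hs

/-- The functional equation at 2k + 2: Γ gives the factorial, and the cosine is (-1)^(k+1), whence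
the minus sign. -/
lemma riemannZeta_neg_odd_div_factorial (k : ℕ) :
    riemannZeta (-2 * (k : ℂ) - 1) / ((2 * k + 1).factorial : ℂ) = -(boseCoeff k : ℂ) := by
  have hs : ∀ n : ℕ, ((2 * k + 2 : ℕ) : ℂ) ≠ -n := by
    intro n h
    have h1 : ((2 * k + 2 + n : ℕ) : ℂ) = 0 := by push_cast at h ⊢; rw [h]; ring
    have : 2 * k + 2 + n = 0 := by exact_mod_cast h1
    omega
  have hs1 : ((2 * k + 2 : ℕ) : ℂ) ≠ 1 := by
    have : 2 * k + 2 ≠ 1 := by omega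
    exact_mod_cast this
  have h := riemannZeta_one_sub hs hs1
  have e1 : (1 : ℂ) - ((2 * k + 2 : ℕ) : ℂ) = -2 * (k : ℂ) - 1 := by push_cast; ring
  have e2 : Complex.Gamma ((2 * k + 2 : ℕ) : ℂ) = ((2 * k + 1).factorial : ℂ) := by
    rw [← Complex.Gamma_nat_eq_factorial]; congr 1; push_cast; ring
  have e3 : Complex.cos (Real.pi * ((2 * k + 2 : ℕ) : ℂ) / 2) = (-1) ^ (k + 1) := by
    have h3 : (Real.pi : ℂ) * ((2 * k + 2 : ℕ) : ℂ) / 2 = (((k + 1 : ℕ) * Real.pi : ℝ) : ℂ) := by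
      push_cast; ring
    rw [h3, ← Complex.ofReal_cos, Real.cos_nat_mul_pi]
    push_cast; rfl
  have e4 : riemannZeta ((2 * k + 2 : ℕ) : ℂ) = (evenZeta k : ℂ) := by
    rw [zeta_eq_tsum_one_div_nat_add_one_cpow (by
      rw [Complex.natCast_re]; exact_mod_cast (by omega : 1 < 2 * k + 2)), evenZeta,
      Complex.ofReal_tsum]
    refine tsum_congr fun m => ?_
    rw [Complex.cpow_natCast]
    push_cast
    rfl
  rw [e1, e2, e3, e4, Complex.cpow_neg, Complex.cpow_natCast] at h
  rw [h, boseCoeff]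
  have hf : ((2 * k + 1).factorial : ℂ) ≠ 0 := by exact_mod_cast Nat.factorial_ne_zero _
  push_cast
  field_simp
  ring

end Taylor

/-! ### Reduction of the hyperbolic kernels to f(x) and f(2x), as rational identities in r = e^(-x).
-/

section Elementary

lemma exp_neg_mul_two (x : ℝ) : Real.exp (-(2 * x)) = Real.exp (-x) ^ 2 := by
  rw [← Real.exp_nat_mul]; congr 1; push_cast; ring

lemma one_div_exp_add_one {x : ℝ} (hx : 0 < x) :
    1 / (Real.exp x + 1) = boseKernel 1 x - 2 * boseKernel 1 (2 * x) := by
  have h1 := (one_sub_exp_neg_pos hx).ne'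
  have h2 : Real.exp x = (Real.exp (-x))⁻¹ := by rw [Real.exp_neg, inv_inv]
  have hr : 0 < Real.exp (-x) := Real.exp_pos _
  rw [boseKernel, boseKernel, exp_neg_mul_two, h2]
  generalize Real.exp (-x) = r at *
  have h3 : 1 - r ^ 2 = (1 - r) * (1 + r) := by ring
  have h4 : 1 + r ≠ 0 := by positivity
  have h5 : r⁻¹ + 1 = (1 + r) / r := by field_simp
  rw [h3, h5]
  field_simp
  ring

lemma one_div_sinh {x : ℝ} (hx : 0 < x) :
    1 / Real.sinh x = 2 * (boseKernel 1 x - boseKernel 1 (2 * x)) := by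
  have h1 := (one_sub_exp_neg_pos hx).ne'
  have h2 : Real.exp x = (Real.exp (-x))⁻¹ := by rw [Real.exp_neg, inv_inv]
  have hr : 0 < Real.exp (-x) := Real.exp_pos _
  rw [Real.sinh_eq, boseKernel, boseKernel, exp_neg_mul_two, h2]
  generalize Real.exp (-x) = r at *
  have h3 : 1 - r ^ 2 = (1 - r) * (1 + r) := by ring
  have h4 : 1 + r ≠ 0 := by positivity
  have h5 : r⁻¹ - r = (1 - r) * (1 + r) / r := by field_simp; ring
  rw [h3, h5]
  field_simp
  ring

lemma exp_neg_div_sinh {x : ℝ} (hx : 0 < x) :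
    Real.exp (-x) / Real.sinh x = 2 * boseKernel 1 (2 * x) := by
  have h1 := (one_sub_exp_neg_pos hx).ne'
  have h2 : Real.exp x = (Real.exp (-x))⁻¹ := by rw [Real.exp_neg, inv_inv]
  have hr : 0 < Real.exp (-x) := Real.exp_pos _
  rw [Real.sinh_eq, boseKernel, exp_neg_mul_two, h2]
  generalize Real.exp (-x) = r at *
  have h3 : 1 - r ^ 2 = (1 - r) * (1 + r) := by ring
  have h4 : 1 + r ≠ 0 := by positivity
  have h5 : r⁻¹ - r = (1 - r) * (1 + r) / r := by field_simp; ring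
  rw [h3, h5]
  field_simp

lemma realCoth_eq {x : ℝ} (hx : 0 < x) : realCoth x = 1 + 2 * boseKernel 1 (2 * x) := by
  have h1 := (one_sub_exp_neg_pos hx).ne'
  have h2 : Real.exp x = (Real.exp (-x))⁻¹ := by rw [Real.exp_neg, inv_inv]
  have hr : 0 < Real.exp (-x) := Real.exp_pos _
  rw [realCoth, Real.sinh_eq, Real.cosh_eq, boseKernel, exp_neg_mul_two, h2]
  generalize Real.exp (-x) = r at *
  have h3 : 1 - r ^ 2 = (1 - r) * (1 + r) := by ring
  have h4 : 1 + r ≠ 0 := by positivity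
  have h5 : r⁻¹ - r = (1 - r) * (1 + r) / r := by field_simp; ring
  rw [h3, h5]
  field_simp
  ring

lemma realCoth_half_eq {x : ℝ} (hx : 0 < x) : realCoth (x / 2) = 1 + 2 * boseKernel 1 x := by
  rw [realCoth_eq (half_pos hx), mul_div_cancel₀ x two_ne_zero]

end Elementary

end BoseSum

/-! ### Assembly of the four identities from the cases c = 1 and c = 2. -/

open BoseSum in
theorem mainTheorem4 (a : ℝ) (ha : 1 < a) :
    -- the sum of the Bose kernel `1 / (e^x - 1)`
    ((Summable fun n : ℕ => 1 / (Real.exp (a ^ n) - 1)) ∧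
      (Summable fun k : ℕ => riemannZeta (-2 * (k : ℂ) - 1) /
        (((2 * k + 1).factorial : ℂ) * ((a : ℂ) ^ (2 * k + 1) - 1))) ∧
      (Summable fun k : ℕ =>
        Complex.Gamma (imagPole a (k + 1)) * riemannZeta (imagPole a (k + 1))) ∧
      ((∑' n : ℕ, 1 / (Real.exp (a ^ n) - 1) : ℝ) : ℂ) =
        (((Real.eulerMascheroniConstant - Real.log (2 * Real.pi * √a)) / Real.log (a ^ 2)
          + a / (a - 1) : ℝ) : ℂ)
        + (∑' k : ℕ, riemannZeta (-2 * (k : ℂ) - 1) /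
            (((2 * k + 1).factorial : ℂ) * ((a : ℂ) ^ (2 * k + 1) - 1)))
        + ((2 / Real.log a * (∑' k : ℕ,
            Complex.Gamma (imagPole a (k + 1)) * riemannZeta (imagPole a (k + 1))).re : ℝ) : ℂ)) ∧
    -- the sum of the Fermi kernel `1 / (e^x + 1)`
    ((Summable fun n : ℕ => 1 / (Real.exp (a ^ n) + 1)) ∧
      (Summable fun k : ℕ =>
        realCoth ((a ^ (k + 1))⁻¹ / 2) - 2 * realCoth ((a ^ (k + 1))⁻¹)) ∧
      (Summable fun k : ℕ => ((2 : ℂ) ^ (-imagPole a (k + 1)) - 1 / 2) *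
        Complex.Gamma (imagPole a (k + 1)) * riemannZeta (imagPole a (k + 1))) ∧
      (∑' n : ℕ, 1 / (Real.exp (a ^ n) + 1)) =
        -(1 / (2 * Real.log a)) * Real.log (2 / (Real.pi * √a))
        - 1 / 2 * (∑' k : ℕ,
            (realCoth ((a ^ (k + 1))⁻¹ / 2) - 2 * realCoth ((a ^ (k + 1))⁻¹)))
        - Real.eulerMascheroniConstant / (2 * Real.log a)
        - 4 / Real.log a * (∑' k : ℕ, ((2 : ℂ) ^ (-imagPole a (k + 1)) - 1 / 2) *
            Complex.Gamma (imagPole a (k + 1)) * riemannZeta (imagPole a (k + 1))).re) ∧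
    -- the sum of `1 / sinh x`
    ((Summable fun n : ℕ => 1 / Real.sinh (a ^ n)) ∧
      (Summable fun k : ℕ =>
        realCoth ((a ^ (k + 1))⁻¹ / 2) - realCoth ((a ^ (k + 1))⁻¹) - a ^ (k + 1)) ∧
      (Summable fun k : ℕ => (1 - (2 : ℂ) ^ (-imagPole a (k + 1))) *
        Complex.Gamma (imagPole a (k + 1)) * riemannZeta (imagPole a (k + 1))) ∧
      (∑' n : ℕ, 1 / Real.sinh (a ^ n)) =
        -(∑' k : ℕ,
            (realCoth ((a ^ (k + 1))⁻¹ / 2) - realCoth ((a ^ (k + 1))⁻¹) - a ^ (k + 1)))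
        - a / (1 - a) - Real.log 2 / Real.log a
        + 4 / Real.log a * (∑' k : ℕ, (1 - (2 : ℂ) ^ (-imagPole a (k + 1))) *
            Complex.Gamma (imagPole a (k + 1)) * riemannZeta (imagPole a (k + 1))).re) ∧
    -- the sum of `e^(-x) / sinh x`
    ((Summable fun n : ℕ => Real.exp (-(a ^ n)) / Real.sinh (a ^ n)) ∧
      (Summable fun k : ℕ => a ^ (k + 1) - realCoth ((a ^ (k + 1))⁻¹)) ∧
      (Summable fun k : ℕ => riemannZeta (imagPole a (k + 1)) *
        Complex.Gamma (imagPole a (k + 1)) * (2 : ℂ) ^ (-imagPole a (k + 1))) ∧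
      (∑' n : ℕ, Real.exp (-(a ^ n)) / Real.sinh (a ^ n)) =
        -(Real.log Real.pi / Real.log a) - 1 / 2 + a / (a - 1)
        + Real.eulerMascheroniConstant / Real.log a
        + (∑' k : ℕ, (a ^ (k + 1) - realCoth ((a ^ (k + 1))⁻¹)))
        + 4 / Real.log a * (∑' k : ℕ, riemannZeta (imagPole a (k + 1)) *
            Complex.Gamma (imagPole a (k + 1)) * (2 : ℂ) ^ (-imagPole a (k + 1))).re) := by
  have ha0 : 0 < a := by linarith
  have hL := Real.log_pos ha
  have hpi := Real.pi_pos
  have hpow : ∀ n : ℕ, 0 < a ^ n := fun n => pow_pos ha0 n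
  have hinv : ∀ n : ℕ, 0 < (a ^ (n + 1))⁻¹ := fun n => inv_pos.mpr (hpow _)
  set Z : ℕ → ℂ := fun k =>
    Complex.Gamma (imagPole a (k + 1)) * riemannZeta (imagPole a (k + 1)) with hZ
  set W : ℕ → ℂ := fun k => (2 : ℂ) ^ (-imagPole a (k + 1)) * Z k with hW
  have hZs : Summable Z := by
    simpa using summable_cpow_mul_Gamma_mul_riemannZeta ha one_pos
  have hWs : Summable W := by
    simpa using summable_cpow_mul_Gamma_mul_riemannZeta ha two_pos
  set f1 : ℕ → ℝ := fun n => boseKernel 1 (a ^ n) with hf1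
  set f2 : ℕ → ℝ := fun n => boseKernel 1 (2 * a ^ n) with hf2
  have hf1s : Summable f1 := by simpa using summable_boseKernel_mul_pow ha one_pos
  have hf2s : Summable f2 := summable_boseKernel_mul_pow ha two_pos
  set r1 : ℕ → ℝ := fun n => boseKernel 1 (a ^ (n + 1))⁻¹ - a ^ (n + 1) + 1 / 2 with hr1
  set r2 : ℕ → ℝ := fun n => boseKernel 1 (2 * (a ^ (n + 1))⁻¹) - a ^ (n + 1) / 2 + 1 / 2 with hr2
  have hr1s : Summable r1 := by simpa [hr1] using summable_boseKernel_sub ha one_pos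
  have hr2s : Summable r2 := summable_boseKernel_sub ha two_pos
  have m1 : ∑' n, f1 n = a / (a - 1) - 1 / 4
      + (Real.eulerMascheroniConstant - Real.log (2 * Real.pi)) / (2 * Real.log a)
      - ∑' n, r1 n + 2 / Real.log a * (∑' k, Z k).re := by
    simpa [hf1, hr1, hZ] using tsum_boseKernel_mul_pow ha one_pos
  have m2 : ∑' n, f2 n = a / (2 * (a - 1)) - 1 / 4
      + (Real.eulerMascheroniConstant - Real.log (2 * Real.pi) + Real.log 2) / (2 * Real.log a)
      - ∑' n, r2 n + 2 / Real.log a * (∑' k, W k).re := by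
    simpa [hf2, hr2, hW, hZ] using tsum_boseKernel_mul_pow ha two_pos
  have hlog2pi : Real.log (2 * Real.pi) = Real.log 2 + Real.log Real.pi :=
    Real.log_mul two_ne_zero hpi.ne'
  have hlogsqrt : Real.log (√a) = Real.log a / 2 := Real.log_sqrt ha0.le
  have hsqrt : √a ≠ 0 := (Real.sqrt_pos.mpr ha0).ne'
  have ha1 : a - 1 ≠ 0 := by linarith
  have ha1' : 1 - a ≠ 0 := by linarith
  refine ⟨?_, ?_, ?_, ?_⟩
  · have e1 : ∀ n : ℕ, 1 / (Real.exp (a ^ n) - 1) = f1 n := fun n =>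
      (boseKernel_one (hpow n)).symm
    -- The zeta series is minus the series of Taylor remainders, which the master identity
    -- subtracts.
    have hT : HasSum (fun k : ℕ => riemannZeta (-2 * (k : ℂ) - 1) /
        (((2 * k + 1).factorial : ℂ) * ((a : ℂ) ^ (2 * k + 1) - 1))) (-((∑' n, r1 n : ℝ) : ℂ)) := by
      refine (Complex.hasSum_ofReal.mpr (hasSum_boseCoeff_div ha)).neg.congr_fun fun k => ?_
      rw [← div_div, riemannZeta_neg_odd_div_factorial]
      push_cast
      rw [neg_div]
    refine ⟨hf1s.congr fun n => (e1 n).symm, hT.summable, hZs, ?_⟩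
    rw [tsum_congr e1, hT.tsum_eq, m1, Real.log_mul (by positivity) hsqrt, hlogsqrt, Real.log_pow]
    rw [← Complex.ofReal_neg, ← Complex.ofReal_add, ← Complex.ofReal_add]
    congr 1
    push_cast
    field_simp
    ring
  · have e1 : ∀ n : ℕ, 1 / (Real.exp (a ^ n) + 1) = f1 n - 2 * f2 n := fun n =>
      one_div_exp_add_one (hpow n)
    -- The terms in a^(k+1) and the constants cancel in this combination, so only remainders are
    -- left and the series converges.
    have e2 : ∀ k : ℕ, realCoth ((a ^ (k + 1))⁻¹ / 2) - 2 * realCoth ((a ^ (k + 1))⁻¹)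
        = 2 * r1 k - 4 * r2 k := by
      intro k
      rw [realCoth_half_eq (hinv k), realCoth_eq (hinv k)]
      simp only [hr1, hr2]
      ring
    have e3 : ∀ k : ℕ, ((2 : ℂ) ^ (-imagPole a (k + 1)) - 1 / 2) *
        Complex.Gamma (imagPole a (k + 1)) * riemannZeta (imagPole a (k + 1))
        = W k - 1 / 2 * Z k := by
      intro k
      simp only [hW, hZ]
      ring
    refine ⟨(hf1s.sub (hf2s.mul_left 2)).congr fun n => (e1 n).symm,
      ((hr1s.mul_left 2).sub (hr2s.mul_left 4)).congr fun n => (e2 n).symm,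
      (hWs.sub (hZs.mul_left (1 / 2))).congr fun n => (e3 n).symm, ?_⟩
    rw [tsum_congr e1, tsum_congr e2, tsum_congr e3, hf1s.tsum_sub (hf2s.mul_left 2),
      (hr1s.mul_left 2).tsum_sub (hr2s.mul_left 4), hWs.tsum_sub (hZs.mul_left (1 / 2)),
      tsum_mul_left, tsum_mul_left, tsum_mul_left, tsum_mul_left, m1, m2,
      Real.log_div two_ne_zero (by positivity), Real.log_mul hpi.ne' hsqrt, hlogsqrt, hlog2pi]
    have hre : (∑' k, W k - 1 / 2 * ∑' k, Z k).re = (∑' k, W k).re - 1 / 2 * (∑' k, Z k).re := by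
      rw [Complex.sub_re]
      congr 1
      have : (1 / 2 : ℂ) = ((1 / 2 : ℝ) : ℂ) := by push_cast; rfl
      rw [this, Complex.re_ofReal_mul]
    rw [hre]
    field_simp
    ring
  · have e1 : ∀ n : ℕ, 1 / Real.sinh (a ^ n) = 2 * (f1 n - f2 n) := fun n =>
      one_div_sinh (hpow n)
    have e2 : ∀ k : ℕ, realCoth ((a ^ (k + 1))⁻¹ / 2) - realCoth ((a ^ (k + 1))⁻¹) - a ^ (k + 1)
        = 2 * (r1 k - r2 k) := by
      intro k
      rw [realCoth_half_eq (hinv k), realCoth_eq (hinv k)]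
      simp only [hr1, hr2]
      ring
    have e3 : ∀ k : ℕ, (1 - (2 : ℂ) ^ (-imagPole a (k + 1))) *
        Complex.Gamma (imagPole a (k + 1)) * riemannZeta (imagPole a (k + 1)) = Z k - W k := by
      intro k
      simp only [hW, hZ]
      ring
    refine ⟨((hf1s.sub hf2s).mul_left 2).congr fun n => (e1 n).symm,
      ((hr1s.sub hr2s).mul_left 2).congr fun n => (e2 n).symm,
      (hZs.sub hWs).congr fun n => (e3 n).symm, ?_⟩
    rw [tsum_congr e1, tsum_congr e2, tsum_congr e3, tsum_mul_left, tsum_mul_left,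
      hf1s.tsum_sub hf2s, hr1s.tsum_sub hr2s, hZs.tsum_sub hWs, m1, m2, Complex.sub_re]
    field_simp
    ring
  · have e1 : ∀ n : ℕ, Real.exp (-(a ^ n)) / Real.sinh (a ^ n) = 2 * f2 n := fun n =>
      exp_neg_div_sinh (hpow n)
    have e2 : ∀ k : ℕ, a ^ (k + 1) - realCoth ((a ^ (k + 1))⁻¹) = -2 * r2 k := by
      intro k
      rw [realCoth_eq (hinv k)]
      simp only [hr2]
      ring
    have e3 : ∀ k : ℕ, riemannZeta (imagPole a (k + 1)) *
        Complex.Gamma (imagPole a (k + 1)) * (2 : ℂ) ^ (-imagPole a (k + 1)) = W k := by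
      intro k
      simp only [hW, hZ]
      ring
    refine ⟨(hf2s.mul_left 2).congr fun n => (e1 n).symm,
      (hr2s.mul_left (-2)).congr fun n => (e2 n).symm, hWs.congr fun n => (e3 n).symm, ?_⟩
    rw [tsum_congr e1, tsum_congr e2, tsum_congr e3, tsum_mul_left, tsum_mul_left, m2, hlog2pi]
    field_simp
    ring
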